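/- For a real number $m>0$, call a mean-zero real random variable $X$ strictly sub-Gaussian with variance $1/m$ if $\mathbb{E}X^2 = 1/m$ and $\mathbb{E}\exp(tX)\le \exp\bigl(t^2/(2m)\bigr)$ for all $t\in\mathbb{R}$. For a real matrix $X=(x_{ij})$ write $\|X\|_0=\#\{(i,j): x_{ij}\neq 0\}$ and $\|X\|_1=\sum_{i,j}|x_{ij}|$. Let $k, m_1, n_1, m_2, n_2$ be nonnegative integers with $2k\le n_1$ and $2k\le n_2$, and let $X^0\in\mathbb{R}^{n_1\times n_2}$ be a fixed matrix with $\|X^0\|_0\le k$. Let $A$ be a random $m_1\times n_1$ matrix and $B$ a random $m_2\times n_2$ matrix, all of whose entries together are independent; the entries of $A$ are strictly sub-Gaussian with variance $1/a$ and those of $B$ are strictly sub-Gaussian with variance $1/b$, where $a,b>0$ are arbitrary (for instance $a=b=m$, or $a=m_1$ and $b=m_2$). The entries need not be identically distributed. Let $C>28.1$ be a constant such that $$m_1\ge C\,k\log(n_1/k)\quad\text{and}\quad m_2\ge C\,k\log(n_2/k)$$ (when $k=0$ the right-hand sides are read as $0$). Put $Y=AX^0B^T$. Then, with probability at least $$1-2\exp\Bigl(-\bigl(0.239-\tfrac{6.7}{C}\bigr)m_1\Bigr)-2\exp\Bigl(-\bigl(0.239-\tfrac{6.7}{C}\bigr)m_2\Bigr),$$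 $X^0$ is the unique optimal solution of the convex program $$(\mathrm{P}_2)\qquad \min_{X\in\mathbb{R}^{n_1\times n_2}}\|X\|_1\quad\text{subject to}\quad AXB^T=Y .$$ -/

import Mathlib

open MeasureTheory ProbabilityTheory

/-- A random variable `X` on `(Ω, P)` is strictly sub-Gaussian with variance `1 / m`: it has mean
zero, `𝔼 X ^ 2 = 1 / m` and `𝔼 exp (t X) ≤ exp (t ^ 2 / (2 m))` for all real `t`.  The finiteness of
the exponential moments, implicit in the last inequality, is a separate field because the Bochner
integral of a non-integrable function is `0`. -/
structure IsStrictlySubGaussian {Ω : Type*} [MeasurableSpace Ω] (X : Ω → ℝ) (m : ℝ)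
    (P : Measure Ω) : Prop where
  measurable : Measurable X
  mean_eq_zero : ∫ ω, X ω ∂P = 0
  second_moment : ∫ ω, X ω ^ 2 ∂P = 1 / m
  integrable_exp : ∀ t : ℝ, Integrable (fun ω => Real.exp (t * X ω)) P
  exp_le : ∀ t : ℝ, ∫ ω, Real.exp (t * X ω) ∂P ≤ Real.exp (t ^ 2 / (2 * m))

/-- `‖X‖₀`, the number of nonzero entries of a matrix. -/
noncomputable def matrixL0 {p q : ℕ} (X : Matrix (Fin p) (Fin q) ℝ) : ℕ :=
  {ij : Fin p × Fin q | X ij.1 ij.2 ≠ 0}.ncard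

/-- `‖X‖₁`, the sum of the absolute values of the entries of a matrix. -/
def matrixL1 {p q : ℕ} (X : Matrix (Fin p) (Fin q) ℝ) : ℝ :=
  ∑ i, ∑ j, |X i j|

/-- The set of all optimal solutions of the convex program
`min ‖X‖₁` subject to `A X Bᵀ = Y`. -/
def kroneckerL1Solutions {m₁ n₁ m₂ n₂ : ℕ} (A : Matrix (Fin m₁) (Fin n₁) ℝ)
    (B : Matrix (Fin m₂) (Fin n₂) ℝ) (Y : Matrix (Fin m₁) (Fin m₂) ℝ) :
    Set (Matrix (Fin n₁) (Fin n₂) ℝ) :=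
  {X | A * X * B.transpose = Y ∧
    ∀ Z : Matrix (Fin n₁) (Fin n₂) ℝ, A * Z * B.transpose = Y → matrixL1 X ≤ matrixL1 Z}

/-!
A matrix `X₀` with at most `k` nonzero entries is supported in a product `I × J` of sets of `k`
rows and `k` columns, which do not depend on the random matrices. The argument is a condition on
`A` relative to `I` and on `B` relative to `J` that combine to uniqueness, together with the proof
that each of them holds with high probability.

**Deterministic part.** The condition is an `ℓ²`-`ℓ¹` null space property (`NullSpaceProperty`):
kernel vectors `w` of `A` satisfy `‖w_I‖₂ ≤ t ‖w_{Iᶜ}‖₁`, with `t² k = 3/5`. Averaging over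
Gaussian functionals extends it, with the same constant, to families of vectors in a Euclidean
space (`NullSpaceProperty.vector`). By Hahn-Banach, the vector-valued form for `B` is dual to the
existence of a linear lift `l` which is the identity on the coordinates in `J`, is small off `J`,
and annihilates the kernel of `B` (`NullSpaceProperty.exists_linear_lift`). If `A h Bᵀ = 0`, then
applying `l` to the rows of `h` gives a family in the kernel of `A`, and the vector-valued
property of `A` bounds the pairing of `h` with the sign matrix of `X₀` by `0.999` times the
`ℓ¹`-norm of `h` off `I × J` (`sum_mul_le_of_nullSpaceProperty`). This is a dual certificate for
`X₀`, and `X₀` is the only minimiser (`kroneckerL1Solutions_eq_singleton`). The sets `I`, `J`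
being fixed, no union bound over the support is needed, and the sparsity that enters is `k` for
each factor.

**Probabilistic part.** Let `G` have independent strictly sub-Gaussian entries of
variance one. A failure of the null
space property is witnessed by a unit vector `x` supported on `J ∪ T₁` and a vector `u` with
entries `±1 / (2 t k)` on a set `T \ T₁`, where `#T = 2 k`, such that `‖G x‖² + ⟨G x, G u⟩ ≤ 0`
(`exists_of_not_nullSpaceProperty`). As `x` and `u` have disjoint supports, `G x` and `G u` are
independent; averaging over `G u` leaves the Laplace transform of `‖G x‖²`, which is bounded
through the fourth moment: strict sub-Gaussianity gives `𝔼 Y⁴ ≤ 3 (𝔼 Y²)²` (`fourth_moment_le`),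
hence `𝔼 exp (-s Y²) ≤ 2/3 + exp (-3 s 𝔼 Y²) / 3` (`integral_exp_neg_mul_sq_le`). The supremum
over `x` is handled by integrating over an annulus around the unit sphere: linear terms average
out over a ball, so the loss is quadratic in its radius, and only the column norms enter it
(`measure_exists_unit_vector_le`). A union bound over `T`, `T₁` and the signs gives the factor
`11 ^ k * 13 ^ (2 k) * binom(n - k, 2 k)`, which `m ≥ 28.1 k log (n / k)` absorbs when `n ≥ 6 k`. For
`n ≤ 6 k` the same estimate, for vectors without restriction on the support, shows that `G` is
injective. The rate `0.239` comes from the tail of the column norms (`measure_column_le`).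
-/

/-! ### The null space property and its vector-valued form -/

/-- The null space property of `A` relative to a fixed set `J` of coordinates, in its `ℓ²`-`ℓ¹`
form: the part on `J` of a vector in the kernel of `A` has Euclidean norm at most `t` times the
`ℓ¹`-norm of the part off `J`. -/
def NullSpaceProperty {m n : ℕ} (A : Matrix (Fin m) (Fin n) ℝ) (J : Finset (Fin n)) (t : ℝ) :
    Prop :=
  ∀ w : Fin n → ℝ, A.mulVec w = 0 → √(∑ j ∈ J, w j ^ 2) ≤ t * ∑ j ∈ Jᶜ, |w j|

/-- By rotation invariance, the first absolute moment of a linear functional under the standard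
Gaussian measure is a fixed multiple of its norm. -/
lemma exists_integral_abs_inner_stdGaussian (V : Type*) [NormedAddCommGroup V]
    [InnerProductSpace ℝ V] [FiniteDimensional ℝ V] [MeasurableSpace V] [BorelSpace V] :
    ∃ c : ℝ, 0 < c ∧ ∀ v : V, ∫ x, |inner ℝ v x| ∂(stdGaussian V) = c * ‖v‖ := by
  rcases subsingleton_or_nontrivial V with hV | hV
  · refine ⟨1, one_pos, fun v => ?_⟩
    simp [Subsingleton.elim v 0]
  obtain ⟨e, he⟩ := exists_norm_eq V zero_le_one
  have hint : Integrable (fun x => inner ℝ e x) (stdGaussian V) :=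
    (innerSL ℝ e).integrable_comp IsGaussian.integrable_id
  refine ⟨∫ x, |inner ℝ e x| ∂(stdGaussian V), ?_, fun v => ?_⟩
  · refine lt_of_le_of_ne (integral_nonneg fun x => abs_nonneg _) fun h0 => ?_
    have h1 : (fun x => |inner ℝ e x|) =ᵐ[stdGaussian V] 0 :=
      (integral_eq_zero_iff_of_nonneg (fun x => abs_nonneg _) hint.abs).1 h0.symm
    have h2 : (innerSL ℝ e : V → ℝ) =ᵐ[stdGaussian V] 0 := by
      filter_upwards [h1] with x hx
      simpa using hx
    have h3 := variance_dual_stdGaussian (E := V) (innerSL ℝ e)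
    rw [variance_congr h2, innerSL_apply_norm, he] at h3
    simp at h3
  · rcases eq_or_ne v 0 with rfl | hv
    · simp
    have hv' : ‖v‖ ≠ 0 := norm_ne_zero_iff.2 hv
    have hn : ‖‖v‖⁻¹ • v‖ = ‖e‖ := by rw [norm_smul, norm_inv, norm_norm, he]; field_simp
    set ρ := Submodule.reflection (Submodule.span ℝ {‖v‖⁻¹ • v - e})ᗮ with hρ
    have h1 : ρ (‖v‖⁻¹ • v) = e := Submodule.reflection_sub hn
    have h2 : ∀ x, |inner ℝ v x| = ‖v‖ * |inner ℝ e (ρ x)| := by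
      intro x
      rw [← h1, ρ.inner_map_map, real_inner_smul_left, abs_mul, abs_inv, abs_norm]
      field_simp
    simp_rw [h2]
    rw [integral_const_mul, mul_comm]
    congr 1
    have h3 := stdGaussian_map (E := V) ρ
    conv_rhs => rw [← h3]
    rw [integral_map]
    · exact ρ.continuous.measurable.aemeasurable
    · fun_prop

/-- The null space property passes to vectors with entries in a Euclidean space, with the same
constant: average the scalar inequality over all Gaussian functionals. -/
theorem NullSpaceProperty.vector {m n : ℕ} {A : Matrix (Fin m) (Fin n) ℝ} {J : Finset (Fin n)}
    {t : ℝ} (ht : 0 ≤ t) (hA : NullSpaceProperty A J t) {V : Type*} [NormedAddCommGroup V]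
    [InnerProductSpace ℝ V] [FiniteDimensional ℝ V] (Z : Fin n → V)
    (hZ : ∀ r, ∑ j, A r j • Z j = 0) :
    √(∑ j ∈ J, ‖Z j‖ ^ 2) ≤ t * ∑ j ∈ Jᶜ, ‖Z j‖ := by
  borelize V
  obtain ⟨c, hc, hcv⟩ := exists_integral_abs_inner_stdGaussian V
  have hint : ∀ v : V, Integrable (fun x => |inner ℝ v x|) (stdGaussian V) := fun v =>
    ((innerSL ℝ v).integrable_comp IsGaussian.integrable_id).abs
  set S := √(∑ j ∈ J, ‖Z j‖ ^ 2) with hS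
  have hS0 : 0 ≤ S := Real.sqrt_nonneg _
  have hSS : S ^ 2 = ∑ j ∈ J, ‖Z j‖ ^ 2 := Real.sq_sqrt (by positivity)
  rcases hS0.eq_or_lt with h0 | hpos
  · rw [← h0]; positivity
  have key : ∀ x : V, ∑ j ∈ J, ‖Z j‖ * |inner ℝ (Z j) x| ≤
      S * (t * ∑ j ∈ Jᶜ, |inner ℝ (Z j) x|) := by
    intro x
    have h1 : ∑ j ∈ J, ‖Z j‖ * |inner ℝ (Z j) x| ≤ S * √(∑ j ∈ J, inner ℝ (Z j) x ^ 2) := by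
      have := Real.sum_mul_le_sqrt_mul_sqrt J (fun j => ‖Z j‖) (fun j => |inner ℝ (Z j) x|)
      simpa only [sq_abs] using this
    refine h1.trans (mul_le_mul_of_nonneg_left (hA _ ?_) hS0)
    ext r
    have := congrArg (fun v => inner ℝ v x) (hZ r)
    simpa [sum_inner, real_inner_smul_left, Matrix.mulVec, dotProduct] using this
  have h2 := integral_mono (μ := stdGaussian V)
    (integrable_finsetSum _ fun j _ => (hint (Z j)).const_mul _)
    (((integrable_finsetSum _ fun j _ => hint (Z j)).const_mul t).const_mul S) key
  rw [integral_finsetSum _ fun j _ => (hint (Z j)).const_mul _, integral_const_mul,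
    integral_const_mul, integral_finsetSum _ fun j _ => hint (Z j)] at h2
  simp_rw [integral_const_mul, hcv] at h2
  have h3 : ∑ j ∈ J, ‖Z j‖ * (c * ‖Z j‖) = c * S * S := by
    rw [mul_assoc, ← sq, hSS, Finset.mul_sum]
    exact Finset.sum_congr rfl fun j _ => by ring
  rw [h3, ← Finset.mul_sum] at h2
  have h4 : c * S * S ≤ c * S * (t * ∑ j ∈ Jᶜ, ‖Z j‖) := by linarith
  exact le_of_mul_le_mul_left h4 (by positivity)

/-- Dual form of the vector-valued null space property, by the Hahn-Banach theorem: vectors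
prescribed on `J` extend to a family which is small off `J` and annihilates the kernel of `A`. -/
theorem NullSpaceProperty.exists_lift {m n : ℕ} {A : Matrix (Fin m) (Fin n) ℝ}
    {J : Finset (Fin n)} {t : ℝ} (ht : 0 ≤ t) (hA : NullSpaceProperty A J t) {V : Type*}
    [NormedAddCommGroup V] [InnerProductSpace ℝ V] [FiniteDimensional ℝ V] (d : Fin n → V) :
    ∃ Q : Fin n → V, (∀ j ∈ J, Q j = d j) ∧
      (∀ j ∉ J, ‖Q j‖ ≤ t * √(∑ j ∈ J, ‖d j‖ ^ 2)) ∧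
      ∀ w : Fin n → ℝ, A.mulVec w = 0 → ∑ j, w j • Q j = 0 := by
  set T := t * √(∑ j ∈ J, ‖d j‖ ^ 2) with hT
  have hT0 : 0 ≤ T := by positivity
  let K : Submodule ℝ (Fin n → V) :=
    { carrier := {Z | ∀ r, ∑ j, A r j • Z j = 0}
      add_mem' := fun {Z Z'} h h' r => by simp [smul_add, Finset.sum_add_distrib, h r, h' r]
      zero_mem' := fun r => by simp
      smul_mem' := fun c Z h r => by
        simp only [Pi.smul_apply, smul_comm _ c]
        rw [← Finset.smul_sum, h r, smul_zero] }
  let φ : (Fin n → V) →ₗ[ℝ] ℝ :=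
    { toFun := fun Z => ∑ j ∈ J, inner ℝ (d j) (Z j)
      map_add' := fun Z Z' => by simp [inner_add_right, Finset.sum_add_distrib]
      map_smul' := fun c Z => by simp [real_inner_smul_right, Finset.mul_sum] }
  obtain ⟨g, hg1, hg2⟩ := exists_extension_of_le_sublinear
    (⟨K, φ.comp K.subtype⟩ : (Fin n → V) →ₗ.[ℝ] ℝ)
    (fun Z => T * ∑ j ∈ Jᶜ, ‖Z j‖)
    (fun c hc Z => by
      simp only [Pi.smul_apply, norm_smul, Real.norm_eq_abs, abs_of_pos hc, ← Finset.mul_sum]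
      ring)
    (fun Z Z' => by
      rw [← mul_add, ← Finset.sum_add_distrib]
      exact mul_le_mul_of_nonneg_left (Finset.sum_le_sum fun j _ => norm_add_le _ _) hT0)
    (fun Z => by
      have h1 := hA.vector ht Z.1 Z.2
      have h2 : φ Z.1 ≤ √(∑ j ∈ J, ‖d j‖ ^ 2) * √(∑ j ∈ J, ‖Z.1 j‖ ^ 2) :=
        (Finset.sum_le_sum fun j _ => real_inner_le_norm _ _).trans
          (Real.sum_mul_le_sqrt_mul_sqrt J (fun j => ‖d j‖) (fun j => ‖Z.1 j‖))
      have h3 := mul_le_mul_of_nonneg_left h1 (Real.sqrt_nonneg (∑ j ∈ J, ‖d j‖ ^ 2))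
      change φ Z.1 ≤ _
      rw [hT]
      linarith)
  have hrep : ∀ j, ∃ p : V, ∀ v, g (Pi.single j v) = inner ℝ p v := fun j =>
    ⟨(InnerProductSpace.toDual ℝ V).symm
      (LinearMap.toContinuousLinearMap (g.comp (LinearMap.single ℝ (fun _ => V) j))), fun v => by
        rw [InnerProductSpace.toDual_symm_apply]; rfl⟩
  choose p hp using hrep
  have hsum : ∀ j v, ∑ i ∈ Jᶜ, ‖(Pi.single j v : Fin n → V) i‖ = if j ∈ J then 0 else ‖v‖ := by
    intro j v
    have : ∀ i, ‖(Pi.single j v : Fin n → V) i‖ = if i = j then ‖v‖ else 0 := by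
      intro i
      by_cases h : i = j
      · subst h; simp
      · simp [h]
    simp_rw [this]
    rw [Finset.sum_ite_eq']
    by_cases h : j ∈ J <;> simp [h]
  have hpJ : ∀ j ∈ J, p j = 0 := by
    intro j hj
    have h := hg2 (Pi.single j (p j))
    rw [hp, hsum, if_pos hj, mul_zero, real_inner_self_eq_norm_sq] at h
    exact norm_eq_zero.1 (pow_eq_zero_iff two_ne_zero |>.1 (le_antisymm h (sq_nonneg _)))
  have hpo : ∀ j ∉ J, ‖p j‖ ≤ T := by
    intro j hj
    have h := hg2 (Pi.single j (p j))
    rw [hp, hsum, if_neg hj, real_inner_self_eq_norm_sq, sq] at h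
    rcases (norm_nonneg (p j)).eq_or_lt with h0 | h0
    · rw [← h0]; exact hT0
    · exact le_of_mul_le_mul_right h h0
  have hgs : ∀ Z, g Z = ∑ j, inner ℝ (p j) (Z j) := by
    intro Z
    conv_lhs => rw [← Finset.univ_sum_single Z]
    rw [map_sum]
    exact Finset.sum_congr rfl fun j _ => hp j _
  refine ⟨fun j => if j ∈ J then d j else -p j, fun j hj => by simp [hj], fun j hj => by
    simpa [hj] using hpo j hj, fun w hw => ?_⟩
  set v := ∑ j, w j • (if j ∈ J then d j else -p j) with hv
  have hK : (fun j => w j • v) ∈ K := fun r => by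
    have := congrFun hw r
    simp only [Matrix.mulVec, dotProduct, Pi.zero_apply] at this
    simp only [smul_smul, ← Finset.sum_smul, this, zero_smul]
  have h1 : g (fun j => w j • v) = φ (fun j => w j • v) := hg1 ⟨_, hK⟩
  rw [hgs] at h1
  have h2 : inner ℝ v v = (0 : ℝ) := by
    conv_lhs => rw [hv, sum_inner]
    have : ∀ j, inner ℝ (w j • (if j ∈ J then d j else -p j)) v =
        (if j ∈ J then inner ℝ (d j) (w j • v) else 0) - inner ℝ (p j) (w j • v) := by
      intro j
      by_cases hj : j ∈ J
      · simp [hj, hpJ j hj, real_inner_smul_left, real_inner_smul_right]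
      · simp [hj, real_inner_smul_left, real_inner_smul_right]
    rw [← hv]
    simp_rw [this]
    rw [Finset.sum_sub_distrib, h1, Finset.sum_ite_mem, Finset.univ_inter]
    exact sub_self _
  exact inner_self_eq_zero.1 h2

/-! ### Recovery from the null space properties of the two factors -/

/-- A linear lift adapted to a matrix `U`: the coordinate vectors `e j` with `j ∈ J` extend to a
family `l` annihilating the kernel of `A`, with `U (l j)` and `l j` both small for `j ∉ J`.
This is `NullSpaceProperty.exists_lift` for the vectors `(U e j, s e j)`, followed by the orthogonal
projection onto the range of `x ↦ (U x, s x)`. -/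
theorem NullSpaceProperty.exists_linear_lift {m n p : ℕ} {A : Matrix (Fin m) (Fin n) ℝ}
    {J : Finset (Fin n)} {t : ℝ} (ht : 0 ≤ t) (hA : NullSpaceProperty A J t)
    (U : Matrix (Fin p) (Fin n) ℝ) {s : ℝ} (hs : s ≠ 0) :
    ∃ l : Fin n → EuclideanSpace ℝ (Fin n),
      (∀ j ∈ J, l j = EuclideanSpace.single j 1) ∧
      (∀ j ∉ J, ∑ i, (U.mulVec (l j)) i ^ 2 + s ^ 2 * ‖l j‖ ^ 2 ≤
        t ^ 2 * ∑ j ∈ J, (∑ i, U i j ^ 2 + s ^ 2)) ∧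
      ∀ w : Fin n → ℝ, A.mulVec w = 0 → ∑ j, w j • l j = 0 := by
  obtain ⟨D, hD⟩ : ∃ D : EuclideanSpace ℝ (Fin n) →ₗ[ℝ] EuclideanSpace ℝ (Fin p ⊕ Fin n),
      ∀ x, D x = WithLp.toLp 2 (Sum.elim (U.mulVec x) (fun j => s * x j)) :=
   ⟨{ toFun := fun x => WithLp.toLp 2 (Sum.elim (U.mulVec x) (fun j => s * x j))
      map_add' := fun x y => by
        ext i
        rcases i with i | i
        · simp [Matrix.mulVec_add]
        · simp [mul_add]
      map_smul' := fun c x => by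
        ext i
        rcases i with i | i
        · simp [Matrix.mulVec_smul]
        · simp [mul_left_comm] }, fun x => rfl⟩
  have hDn : ∀ x, ‖D x‖ ^ 2 = ∑ i, (U.mulVec x) i ^ 2 + s ^ 2 * ‖x‖ ^ 2 := by
    intro x
    rw [EuclideanSpace.real_norm_sq_eq, EuclideanSpace.real_norm_sq_eq, Fintype.sum_sum_type,
      Finset.mul_sum]
    simp [hD, mul_pow]
  obtain ⟨Q, hQJ, hQo, hQk⟩ := hA.exists_lift ht (fun j => D (EuclideanSpace.single j 1))
  have hproj : ∀ j, ∃ x, D x = (LinearMap.range D).starProjection (Q j) := fun j =>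
    LinearMap.mem_range.1 (Submodule.starProjection_apply_mem (LinearMap.range D) (Q j))
  choose l hl using hproj
  have hinj : Function.Injective D := by
    intro x y hxy
    ext j
    have := congrArg (fun v : EuclideanSpace ℝ (Fin p ⊕ Fin n) => v (Sum.inr j)) hxy
    simpa [hD, hs] using this
  refine ⟨l, fun j hj => hinj ?_, fun j hj => ?_, fun w hw => hinj ?_⟩
  · rw [hl, hQJ j hj, Submodule.starProjection_eq_self_iff.2 (LinearMap.mem_range_self _ _)]
  · rw [← hDn, hl]
    have h1 : ‖(LinearMap.range D).starProjection (Q j)‖ ≤ ‖Q j‖ :=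
      Submodule.norm_starProjection_apply_le _ _
    have h2 := pow_le_pow_left₀ (norm_nonneg _) (h1.trans (hQo j hj)) 2
    refine h2.trans (le_of_eq ?_)
    rw [mul_pow, Real.sq_sqrt (Finset.sum_nonneg fun j _ => sq_nonneg _)]
    congr 1
    refine Finset.sum_congr rfl fun j _ => ?_
    rw [hDn]
    simp
  · have h := congrArg (LinearMap.range D).starProjection (hQk w hw)
    rw [map_sum, map_zero] at h
    rw [map_sum, map_zero, ← h]
    exact Finset.sum_congr rfl fun j _ => by rw [map_smul, map_smul, hl]

/-- If `A` and `B` have the null space property relative to `I` and `J` and `A h Bᵀ = 0`, then the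
pairing of `h` with a matrix `U` supported in `I × J` is controlled by the part of `h` outside
`I × J`.  The lift for `B` turns `h` into a family of vectors in the kernel of `A`, to which the
vector-valued null space property of `A` applies.  Put `θ² = k t² ≤ 3/5` and let `s = 4/5` be the weight
in the lift.  The blocks `I × Jᶜ`, `Iᶜ × J` and `Iᶜ × Jᶜ` get the squared coefficients
`θ² (1 + s²)`, `θ²` and `θ⁴ (1 + s²) / s²`, all below `1`. -/
theorem sum_mul_le_of_nullSpaceProperty {m₁ n₁ m₂ n₂ : ℕ} {A : Matrix (Fin m₁) (Fin n₁) ℝ}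
    {B : Matrix (Fin m₂) (Fin n₂) ℝ} {I : Finset (Fin n₁)} {J : Finset (Fin n₂)} {t : ℝ} {k : ℕ}
    (ht : 0 ≤ t) (htk : t ^ 2 * k ≤ 3 / 5) (hA : NullSpaceProperty A I t)
    (hB : NullSpaceProperty B J t) (hJ : J.card ≤ k) (U : Matrix (Fin n₁) (Fin n₂) ℝ)
    (hU : ∀ i j, U i j ≠ 0 → i ∈ I ∧ j ∈ J) (hUk : ∑ i, ∑ j, U i j ^ 2 ≤ k)
    (h : Matrix (Fin n₁) (Fin n₂) ℝ) (hh : A * h * B.transpose = 0) :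
    ∑ i, ∑ j, U i j * h i j ≤
      (999 / 1000) * ∑ i, ∑ j, if i ∈ I ∧ j ∈ J then 0 else |h i j| := by
  obtain ⟨l, hlJ, hlo, hlk⟩ := hB.exists_linear_lift ht U (s := 4 / 5) (by norm_num)
  have hUcol : ∑ j ∈ J, ∑ i, U i j ^ 2 ≤ k := by
    refine le_trans ?_ hUk
    rw [Finset.sum_comm]
    exact Finset.sum_le_sum fun i _ =>
      Finset.sum_le_univ_sum_of_nonneg fun j => sq_nonneg _
  have hoff : ∀ j ∉ J, ∑ i, (U.mulVec (l j)) i ^ 2 + (4 / 5) ^ 2 * ‖l j‖ ^ 2 ≤ 123 / 125 := by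
    intro j hj
    refine (hlo j hj).trans ?_
    rw [Finset.sum_add_distrib, Finset.sum_const, nsmul_eq_mul]
    have : (J.card : ℝ) ≤ k := by exact_mod_cast hJ
    calc t ^ 2 * (∑ j ∈ J, ∑ i, U i j ^ 2 + J.card * (4 / 5) ^ 2)
        ≤ t ^ 2 * (k + k * (4 / 5) ^ 2) := by gcongr
      _ = t ^ 2 * k * (41 / 25) := by ring
      _ ≤ 3 / 5 * (41 / 25) := by gcongr
      _ = _ := by norm_num
  have hoff1 : ∀ i, ∀ j ∉ J, |U.mulVec (l j) i| ≤ 999 / 1000 := by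
    intro i j hj
    refine abs_le_of_sq_le_sq ?_ (by norm_num)
    have h1 : (U.mulVec (l j)) i ^ 2 ≤ ∑ i, (U.mulVec (l j)) i ^ 2 :=
      Finset.single_le_sum (f := fun i => (U.mulVec (l j)) i ^ 2) (fun i _ => sq_nonneg _)
        (Finset.mem_univ i)
    nlinarith [hoff j hj, sq_nonneg ‖l j‖]
  set θ : ℝ := t * √k with hθ
  have hθ0 : 0 ≤ θ := by positivity
  have hθ2 : θ ^ 2 ≤ 3 / 5 := by rw [hθ, mul_pow, Real.sq_sqrt (by positivity)]; exact htk
  have hθ1 : θ ≤ 999 / 1000 := by nlinarith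
  have hoff2 : ∀ j ∉ J, θ * ‖l j‖ ≤ 999 / 1000 := by
    intro j hj
    refine le_of_sq_le_sq ?_ (by norm_num)
    have h1 : (4 / 5) ^ 2 * ‖l j‖ ^ 2 ≤ 123 / 125 := by
      have : 0 ≤ ∑ i, (U.mulVec (l j)) i ^ 2 := Finset.sum_nonneg fun i _ => sq_nonneg _
      linarith [hoff j hj]
    rw [mul_pow]
    nlinarith [sq_nonneg ‖l j‖]
  have hon : ∀ j ∈ J, ‖l j‖ = 1 := fun j hj => by simp [hlJ j hj]
  -- the vectors `Z i` form a family in the kernel of `A`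
  set Z : Fin n₁ → EuclideanSpace ℝ (Fin n₂) := fun i => ∑ j, h i j • l j with hZ
  have hZk : ∀ r, ∑ i, A r i • Z i = 0 := by
    intro r
    have h1 : B.mulVec (fun j => (A * h) r j) = 0 := by
      ext q
      have := congrFun (congrFun hh r) q
      simpa [Matrix.mul_apply, Matrix.mulVec, dotProduct, mul_comm] using this
    have h2 := hlk _ h1
    rw [← h2]
    simp only [hZ, Finset.smul_sum, Matrix.mul_apply, Finset.sum_smul, smul_smul]
    rw [Finset.sum_comm]
  have hvec := hA.vector ht Z hZk
  set u : Fin n₁ → EuclideanSpace ℝ (Fin n₂) := fun i => WithLp.toLp 2 (U i) with hu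
  have hun : ∑ i ∈ I, ‖u i‖ ^ 2 ≤ k := by
    refine le_trans ?_ hUk
    simp only [hu, EuclideanSpace.real_norm_sq_eq]
    exact Finset.sum_le_univ_sum_of_nonneg fun i => Finset.sum_nonneg fun j _ => sq_nonneg _
  have hip : ∑ i ∈ I, inner ℝ (u i) (Z i) ≤ θ * ∑ i ∈ Iᶜ, ‖Z i‖ := by
    calc ∑ i ∈ I, inner ℝ (u i) (Z i) ≤ ∑ i ∈ I, ‖u i‖ * ‖Z i‖ :=
          Finset.sum_le_sum fun i _ => real_inner_le_norm _ _
      _ ≤ √(∑ i ∈ I, ‖u i‖ ^ 2) * √(∑ i ∈ I, ‖Z i‖ ^ 2) :=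
          Real.sum_mul_le_sqrt_mul_sqrt I _ _
      _ ≤ √k * (t * ∑ i ∈ Iᶜ, ‖Z i‖) := by gcongr
      _ = _ := by rw [hθ]; ring
  -- both sides of `hip` in terms of the entries of `h`
  have hui : ∀ i j, inner ℝ (u i) (l j) = U.mulVec (l j) i := by
    intro i j
    simp [hu, PiLp.inner_apply, Matrix.mulVec, dotProduct, mul_comm]
  have hleft : ∀ i, ∑ j, U i j * h i j - (999 / 1000) * ∑ j ∈ Jᶜ, |h i j| ≤
      inner ℝ (u i) (Z i) := by
    intro i
    have h1 : inner ℝ (u i) (Z i) = ∑ j, h i j * U.mulVec (l j) i := by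
      simp only [hZ, inner_sum, real_inner_smul_right, hui]
    have h2 : ∑ j, U i j * h i j = ∑ j ∈ J, h i j * U.mulVec (l j) i := by
      rw [← Finset.sum_subset (Finset.subset_univ J)]
      · refine Finset.sum_congr rfl fun j hj => ?_
        rw [hlJ j hj, mul_comm]
        simp
      · intro j _ hj
        have : U i j = 0 := by
          by_contra hne
          exact hj (hU i j hne).2
        simp [this]
    rw [h1, h2, ← Finset.sum_add_sum_compl J, Finset.mul_sum, sub_eq_add_neg,
      ← Finset.sum_neg_distrib]
    gcongr with j hj
    have h3 := hoff1 i j (Finset.mem_compl.1 hj)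
    have h4 : |h i j * U.mulVec (l j) i| ≤ |h i j| * (999 / 1000) := by
      rw [abs_mul]; gcongr
    linarith [neg_abs_le (h i j * U.mulVec (l j) i)]
  have hright : ∀ i, θ * ‖Z i‖ ≤ (999 / 1000) * ∑ j, |h i j| := by
    intro i
    calc θ * ‖Z i‖ ≤ θ * ∑ j, |h i j| * ‖l j‖ := by
          gcongr
          refine (norm_sum_le _ _).trans (le_of_eq ?_)
          simp [norm_smul]
      _ = ∑ j, |h i j| * (θ * ‖l j‖) := by
          rw [Finset.mul_sum]; exact Finset.sum_congr rfl fun j _ => by ring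
      _ ≤ ∑ j, |h i j| * (999 / 1000) := by
          gcongr with j
          by_cases hj : j ∈ J
          · rw [hon j hj, mul_one]; exact hθ1
          · exact hoff2 j hj
      _ = _ := by rw [← Finset.sum_mul, mul_comm]
  have hsplit : ∑ i, ∑ j, (if i ∈ I ∧ j ∈ J then 0 else |h i j|) =
      ∑ i ∈ I, ∑ j ∈ Jᶜ, |h i j| + ∑ i ∈ Iᶜ, ∑ j, |h i j| := by
    rw [← Finset.sum_add_sum_compl I]
    congr 1
    · refine Finset.sum_congr rfl fun i hi => ?_
      rw [← Finset.sum_add_sum_compl J, Finset.sum_eq_zero, zero_add]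
      · exact Finset.sum_congr rfl fun j hj => by simp [Finset.mem_compl.1 hj]
      · intro j hj; simp [hi, hj]
    · exact Finset.sum_congr rfl fun i hi => by simp [Finset.mem_compl.1 hi]
  have hUI : ∑ i, ∑ j, U i j * h i j = ∑ i ∈ I, ∑ j, U i j * h i j := by
    refine (Finset.sum_subset (Finset.subset_univ I) fun i _ hi => ?_).symm
    refine Finset.sum_eq_zero fun j _ => ?_
    have : U i j = 0 := by
      by_contra hne
      exact hi (hU i j hne).1
    simp [this]
  have h5 := Finset.sum_le_sum fun i (_ : i ∈ I) => hleft i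
  rw [Finset.sum_sub_distrib, ← Finset.mul_sum] at h5
  have h6 := Finset.sum_le_sum fun i (_ : i ∈ Iᶜ) => hright i
  rw [← Finset.mul_sum, ← Finset.mul_sum] at h6
  rw [hsplit, hUI]
  linarith

/-- A kernel vector supported in `J` vanishes. -/
lemma NullSpaceProperty.eq_zero {m n : ℕ} {A : Matrix (Fin m) (Fin n) ℝ} {J : Finset (Fin n)}
    {t : ℝ} (hA : NullSpaceProperty A J t) {w : Fin n → ℝ} (hw : A.mulVec w = 0)
    (hJ : ∀ j ∉ J, w j = 0) : w = 0 := by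
  have h1 := hA w hw
  rw [Finset.sum_eq_zero (s := Jᶜ) fun j hj => by simp [hJ j (Finset.mem_compl.1 hj)], mul_zero,
    Real.sqrt_le_iff] at h1
  have h2 : ∑ j ∈ J, w j ^ 2 = 0 :=
    le_antisymm (by simpa using h1.2) (Finset.sum_nonneg fun j _ => sq_nonneg _)
  ext j
  by_cases hj : j ∈ J
  · simpa using (Finset.sum_eq_zero_iff_of_nonneg fun j _ => sq_nonneg _).1 h2 j hj
  · exact hJ j hj

/-- The null space properties of `A` and `B` relative to the rows and columns met by the support of
`X₀` imply that `X₀` is the unique `ℓ¹`-minimiser. -/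
theorem kroneckerL1Solutions_eq_singleton {m₁ n₁ m₂ n₂ : ℕ} {A : Matrix (Fin m₁) (Fin n₁) ℝ}
    {B : Matrix (Fin m₂) (Fin n₂) ℝ} {I : Finset (Fin n₁)} {J : Finset (Fin n₂)} {t : ℝ} {k : ℕ}
    (ht : 0 ≤ t) (htk : t ^ 2 * k ≤ 3 / 5) (hA : NullSpaceProperty A I t)
    (hB : NullSpaceProperty B J t) (hJ : J.card ≤ k) (X₀ : Matrix (Fin n₁) (Fin n₂) ℝ)
    (hX₀ : ∀ i j, X₀ i j ≠ 0 → i ∈ I ∧ j ∈ J) (hk : matrixL0 X₀ ≤ k) :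
    kroneckerL1Solutions A B (A * X₀ * B.transpose) = {X₀} := by
  classical
  set U : Matrix (Fin n₁) (Fin n₂) ℝ := fun i j => SignType.sign (X₀ i j) with hUdef
  have hUk : ∑ i, ∑ j, U i j ^ 2 ≤ k := by
    have h1 : ∀ i j, U i j ^ 2 = if X₀ i j ≠ 0 then (1 : ℝ) else 0 := by
      intro i j
      rcases lt_trichotomy (X₀ i j) 0 with h | h | h
      · simp [hUdef, h, h.ne]
      · simp [hUdef, h]
      · simp [hUdef, h, h.ne']
    have h2 : ∑ i, ∑ j, U i j ^ 2 = matrixL0 X₀ := by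
      simp_rw [h1]
      rw [← Fintype.sum_prod_type' (fun i j => if X₀ i j ≠ 0 then (1 : ℝ) else 0), matrixL0,
        Finset.sum_boole, Set.ncard_eq_toFinset_card']
      simp
    rw [h2]; exact_mod_cast hk
  have hU : ∀ i j, U i j ≠ 0 → i ∈ I ∧ j ∈ J := by
    intro i j h
    refine hX₀ i j fun h0 => h ?_
    simp [hUdef, h0]
  -- no other feasible matrix has an `ℓ¹`-norm as small as that of `X₀`
  have key : ∀ W : Matrix (Fin n₁) (Fin n₂) ℝ, A * W * B.transpose = A * X₀ * B.transpose →
      matrixL1 W ≤ matrixL1 X₀ → W = X₀ := by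
    intro W hW hle
    set h := W - X₀ with hh
    have hk0 : A * (-h) * B.transpose = 0 := by
      rw [hh]; simp [Matrix.mul_sub, Matrix.sub_mul, hW]
    have h1 := sum_mul_le_of_nullSpaceProperty ht htk hA hB hJ U hU hUk (-h) hk0
    have h2 : ∀ i j, |X₀ i j| + U i j * h i j + (if X₀ i j = 0 then |h i j| else 0) ≤ |W i j| := by
      intro i j
      have hWij : W i j = X₀ i j + h i j := by simp [hh]
      rw [hWij]
      rcases lt_trichotomy (X₀ i j) 0 with h0 | h0 | h0
      · simp only [hUdef, sign_neg h0, h0.ne, if_false, abs_of_neg h0]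
        have := neg_abs_le (X₀ i j + h i j)
        simp only [SignType.coe_neg_one]
        linarith
      · simp [hUdef, h0]
      · simp only [hUdef, sign_pos h0, h0.ne', if_false, abs_of_pos h0]
        have := le_abs_self (X₀ i j + h i j)
        simp only [SignType.coe_one]
        linarith
    have h3 : ∑ i, ∑ j, (if i ∈ I ∧ j ∈ J then 0 else |(-h) i j|) ≤
        ∑ i, ∑ j, (if X₀ i j = 0 then |h i j| else 0) := by
      refine Finset.sum_le_sum fun i _ => Finset.sum_le_sum fun j _ => ?_
      by_cases hij : X₀ i j = 0
      · rw [if_pos hij]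
        split_ifs
        · exact abs_nonneg _
        · simp
      · rw [if_neg hij, if_pos (hX₀ i j hij)]
    have h4 : matrixL1 X₀ + ∑ i, ∑ j, U i j * h i j +
        ∑ i, ∑ j, (if X₀ i j = 0 then |h i j| else 0) ≤ matrixL1 W := by
      unfold matrixL1
      simp_rw [← Finset.sum_add_distrib]
      exact Finset.sum_le_sum fun i _ => Finset.sum_le_sum fun j _ => h2 i j
    have h5 : ∑ i, ∑ j, U i j * (-h) i j = -∑ i, ∑ j, U i j * h i j := by
      simp [Finset.sum_neg_distrib]
    rw [h5] at h1
    have hnn : 0 ≤ ∑ i, ∑ j, (if X₀ i j = 0 then |h i j| else 0) :=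
      Finset.sum_nonneg fun i _ => Finset.sum_nonneg fun j _ => by split_ifs <;> positivity
    have h6 : ∑ i, ∑ j, (if X₀ i j = 0 then |h i j| else 0) = 0 := by linarith
    have h7 : ∀ i j, X₀ i j = 0 → h i j = 0 := by
      intro i j hij
      have h8 := (Finset.sum_eq_zero_iff_of_nonneg fun i _ =>
        Finset.sum_nonneg fun j _ => by split_ifs <;> positivity).1 h6 i (Finset.mem_univ i)
      have h9 := (Finset.sum_eq_zero_iff_of_nonneg fun j _ => by
        split_ifs <;> positivity).1 h8 j (Finset.mem_univ j)
      simpa [hij] using h9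
    have h8 : ∀ i j, ¬ (i ∈ I ∧ j ∈ J) → h i j = 0 := fun i j hij =>
      h7 i j (by by_contra hne; exact hij (hX₀ i j hne))
    have h9 : A * (h * B.transpose) = 0 := by
      rw [← Matrix.mul_assoc]; simpa using hk0
    have h10 : h * B.transpose = 0 := by
      ext i q
      refine congrFun (hA.eq_zero (w := fun i => (h * B.transpose) i q) ?_ ?_) i
      · ext r
        exact congrFun (congrFun h9 r) q
      · intro i hi
        simp only [Matrix.mul_apply]
        exact Finset.sum_eq_zero fun j _ => by rw [h8 i j fun hij => hi hij.1, zero_mul]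
    have h11 : h = 0 := by
      ext i j
      refine congrFun (hB.eq_zero (w := h i) ?_ fun j hj => h8 i j fun hij => hj hij.2) j
      ext q
      have := congrFun (congrFun h10 i) q
      simpa [Matrix.mul_apply, Matrix.mulVec, dotProduct, mul_comm] using this
    exact sub_eq_zero.1 h11
  ext W
  simp only [kroneckerL1Solutions, Set.mem_ofPred_eq, Set.mem_singleton_iff]
  constructor
  · rintro ⟨h1, h2⟩
    exact key W h1 (h2 X₀ rfl)
  · rintro rfl
    refine ⟨rfl, fun W' hW' => ?_⟩
    by_contra hlt
    rw [key W' hW' (not_le.1 hlt).le] at hlt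
    exact hlt le_rfl

/-! ### Lower tails from the second and fourth moments -/

lemma exp_neg_le_quadratic {z : ℝ} (hz : 0 ≤ z) : Real.exp (-z) ≤ 1 - z + z ^ 2 / 2 := by
  have h1 := Real.quadratic_le_exp_of_nonneg hz
  rw [Real.exp_neg, inv_le_iff_one_le_mul₀ (Real.exp_pos z)]
  have h2 : 0 ≤ 1 - z + z ^ 2 / 2 := by nlinarith [sq_nonneg (z - 1)]
  nlinarith [mul_le_mul_of_nonneg_left h1 h2, sq_nonneg (z ^ 2)]

/-- `exp y - 1 - y` is superhomogeneous of degree two on the nonnegative reals: for fixed `c`, the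
difference of the two sides has nonnegative derivative in `S` by convexity of `exp`. -/
lemma exp_mul_sub_le {c S : ℝ} (hc0 : 0 ≤ c) (hc1 : c ≤ 1) (hS : 0 ≤ S) :
    Real.exp (c * S) - 1 - c * S ≤ c ^ 2 * (Real.exp S - 1 - S) := by
  let D : ℝ → ℝ := fun S => c ^ 2 * (Real.exp S - 1 - S) - (Real.exp (c * S) - 1 - c * S)
  have hd : ∀ x, HasDerivAt D (c ^ 2 * (Real.exp x - 1) - (Real.exp (c * x) * c - c)) x := by
    intro x
    have h1 : HasDerivAt (fun S : ℝ => c * S) c x := by simpa using (hasDerivAt_id x).const_mul c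
    exact ((((Real.hasDerivAt_exp x).sub_const 1).sub (hasDerivAt_id x)).const_mul (c ^ 2)).sub
      ((h1.exp.sub_const 1).sub h1)
  have hmono : MonotoneOn D (Set.Ici 0) := by
    refine monotoneOn_of_deriv_nonneg (convex_Ici 0)
      (fun x _ => (hd x).continuousAt.continuousWithinAt)
      (fun x _ => (hd x).differentiableAt.differentiableWithinAt) fun x _ => ?_
    rw [(hd x).deriv]
    have h2 := convexOn_exp.2 (Set.mem_univ x) (Set.mem_univ 0) hc0 (sub_nonneg.2 hc1) (by ring)
    simp only [smul_eq_mul, mul_zero, add_zero, Real.exp_zero, mul_one] at h2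
    nlinarith
  have := hmono (Set.mem_Ici.2 le_rfl) (Set.mem_Ici.2 hS) hS
  simp only [D, mul_zero, Real.exp_zero] at this
  linarith

/-- The parabola through `(0, 1)` that touches `v ↦ exp (-S v)` at `v = 1` lies above it. -/
lemma exp_neg_mul_le_parabola {S v : ℝ} (hS : 0 ≤ S) (hv : 0 ≤ v) :
    Real.exp (-(S * v)) ≤ Real.exp (-S) * (1 + S * (1 - v)) +
      (1 - Real.exp (-S) * (1 + S)) * (1 - v) ^ 2 := by
  have key : Real.exp (S * (1 - v)) ≤
      1 + S * (1 - v) + (1 - v) ^ 2 * (Real.exp S - 1 - S) := by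
    rcases le_total v 1 with h | h
    · have := exp_mul_sub_le (c := 1 - v) (S := S) (by linarith) (by linarith) hS
      rw [mul_comm S]
      linarith
    · have h1 := exp_neg_le_quadratic (z := S * (v - 1)) (mul_nonneg hS (by linarith))
      have h2 := Real.quadratic_le_exp_of_nonneg hS
      have h3 : -(S * (v - 1)) = S * (1 - v) := by ring
      rw [h3] at h1
      nlinarith [mul_le_mul_of_nonneg_left h2 (sq_nonneg (1 - v))]
  have h1 : Real.exp (-(S * v)) = Real.exp (-S) * Real.exp (S * (1 - v)) := by
    rw [← Real.exp_add]; congr 1; ring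
  rw [h1]
  have h2 : Real.exp (-S) * Real.exp S = 1 := by rw [← Real.exp_add]; simp
  have h3 := mul_le_mul_of_nonneg_left key (Real.exp_pos (-S)).le
  refine h3.trans (le_of_eq ?_)
  linear_combination (1 - v) ^ 2 * h2

lemma one_add_sq_add_pow_four_le_cosh (x : ℝ) : 1 + x ^ 2 / 2 + x ^ 4 / 24 ≤ Real.cosh x := by
  have h := Real.hasSum_cosh x
  have h1 := sum_le_hasSum (Finset.range 3) (fun n _ => by
    rw [pow_mul]; positivity) h
  refine le_trans (le_of_eq ?_) h1
  simp [Finset.sum_range_succ, Nat.factorial]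

section
variable {Ω : Type*} [MeasurableSpace Ω] {P : Measure Ω}

lemma integrable_sq_and_pow_four {Y : Ω → ℝ} {c : NNReal} (hY : HasSubgaussianMGF Y c P) :
    Integrable (fun ω => Y ω ^ 2) P ∧ Integrable (fun ω => Y ω ^ 4) P := by
  constructor
  · have := (hY.memLp 2).integrable_norm_pow (p := 2) (by norm_num)
    simpa [Real.norm_eq_abs, sq_abs] using this
  · have := (hY.memLp 4).integrable_norm_pow (p := 4) (by norm_num)
    simpa [Real.norm_eq_abs, Even.pow_abs (by decide : Even 4)] using this

lemma integral_biquadratic [IsProbabilityMeasure P] {Y : Ω → ℝ}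
    (h2 : Integrable (fun ω => Y ω ^ 2) P) (h4 : Integrable (fun ω => Y ω ^ 4) P) (p q r : ℝ) :
    Integrable (fun ω => p + q * Y ω ^ 2 + r * Y ω ^ 4) P ∧
      ∫ ω, (p + q * Y ω ^ 2 + r * Y ω ^ 4) ∂P =
        p + q * ∫ ω, Y ω ^ 2 ∂P + r * ∫ ω, Y ω ^ 4 ∂P := by
  have h0 : Integrable (fun ω => p + q * Y ω ^ 2) P := (integrable_const _).add (h2.const_mul _)
  refine ⟨h0.add (h4.const_mul _), ?_⟩
  rw [integral_add h0 (h4.const_mul _), integral_add (integrable_const _) (h2.const_mul _),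
    integral_const_mul, integral_const_mul]
  simp

/-- A sub-Gaussian variable whose variance equals its sub-Gaussian constant has fourth moment at
most that of the Gaussian: compare the coefficients of `t ^ 4` in `𝔼 cosh (t Y) ≤ exp (c t² / 2)`. -/
lemma fourth_moment_le [IsProbabilityMeasure P] {Y : Ω → ℝ} {c : NNReal}
    (hY : HasSubgaussianMGF Y c P) (h2 : ∫ ω, Y ω ^ 2 ∂P = c) :
    ∫ ω, Y ω ^ 4 ∂P ≤ 3 * (c : ℝ) ^ 2 := by
  obtain ⟨hi2, hi4⟩ := integrable_sq_and_pow_four hY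
  have key : ∀ t : ℝ, 0 < t → c * t ^ 2 / 2 ≤ 1 →
      ∫ ω, Y ω ^ 4 ∂P ≤ 3 * (c : ℝ) ^ 2 + 24 * ((c : ℝ) ^ 3 * t ^ 2) := by
    intro t ht hs
    have hq := integral_biquadratic hi2 hi4 1 (t ^ 2 / 2) (t ^ 4 / 24)
    have h3 : ∫ ω, (1 + t ^ 2 / 2 * Y ω ^ 2 + t ^ 4 / 24 * Y ω ^ 4) ∂P ≤
        ∫ ω, Real.cosh (t * Y ω) ∂P := by
      refine integral_mono hq.1 ?_ fun ω => ?_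
      · simp_rw [Real.cosh_eq]
        refine ((hY.integrable_exp_mul t).add ?_).div_const 2
        simpa using hY.integrable_exp_mul (-t)
      · refine le_trans (le_of_eq ?_) (one_add_sq_add_pow_four_le_cosh (t * Y ω))
        ring
    have h4 : ∫ ω, Real.cosh (t * Y ω) ∂P ≤ Real.exp (c * t ^ 2 / 2) := by
      simp_rw [Real.cosh_eq]
      have h5 : ∀ ω, Real.exp (-(t * Y ω)) = Real.exp (-t * Y ω) := fun ω => by ring_nf
      simp_rw [h5]
      rw [integral_div, integral_add (hY.integrable_exp_mul t) (hY.integrable_exp_mul (-t))]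
      have h6 := hY.mgf_le t
      have h7 := hY.mgf_le (-t)
      simp only [mgf, neg_sq] at h6 h7
      linarith
    rw [hq.2, h2] at h3
    have hs0 : 0 ≤ c * t ^ 2 / 2 := by positivity
    have h6 := Real.exp_bound (x := c * t ^ 2 / 2) (by rwa [abs_of_nonneg hs0]) (n := 3)
      (by norm_num)
    rw [abs_of_nonneg hs0] at h6
    have h7 := (abs_le.1 h6).2
    simp only [Finset.sum_range_succ, Finset.sum_range_zero, Nat.factorial] at h7
    norm_num at h7
    have h8 : t ^ 4 * (∫ ω, Y ω ^ 4 ∂P) ≤ t ^ 4 * (3 * (c : ℝ) ^ 2 + 24 * ((c : ℝ) ^ 3 * t ^ 2)) := by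
      have : 0 ≤ (c : ℝ) ^ 3 * t ^ 6 := by positivity
      nlinarith
    exact le_of_mul_le_mul_left h8 (by positivity)
  have hlim : Filter.Tendsto (fun t : ℝ => 3 * (c : ℝ) ^ 2 + 24 * ((c : ℝ) ^ 3 * t ^ 2))
      (nhdsWithin 0 (Set.Ioi 0)) (nhds (3 * (c : ℝ) ^ 2)) := by
    have : Continuous fun t : ℝ => 3 * (c : ℝ) ^ 2 + 24 * ((c : ℝ) ^ 3 * t ^ 2) := by fun_prop
    have := this.tendsto 0
    simp only [ne_eq, OfNat.ofNat_ne_zero, not_false_eq_true, zero_pow, mul_zero, add_zero] at this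
    exact this.mono_left nhdsWithin_le_nhds
  refine ge_of_tendsto hlim ?_
  have hsmall : ∀ᶠ t : ℝ in nhdsWithin 0 (Set.Ioi 0), c * t ^ 2 / 2 < 1 := by
    have : Continuous fun t : ℝ => c * t ^ 2 / 2 := by fun_prop
    have := this.tendsto 0
    simp only [ne_eq, OfNat.ofNat_ne_zero, not_false_eq_true, zero_pow, mul_zero, zero_div] at this
    exact (this.mono_left nhdsWithin_le_nhds).eventually (gt_mem_nhds one_pos)
  filter_upwards [hsmall, self_mem_nhdsWithin] with t h1 h2
  exact key t h2 h1.le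

/-- Lower-tail Laplace transform: `exp (-s Y²)` is dominated by the parabola in `Y²` that
interpolates it at `0` and, doubly, at `3a`; its expectation is largest for the law that puts mass
`1/3` at `Y² = 3a` and `2/3` at `0`. -/
lemma integral_exp_neg_mul_sq_le [IsProbabilityMeasure P] {Y : Ω → ℝ} {c : NNReal}
    (hY : HasSubgaussianMGF Y c P) (h2 : ∫ ω, Y ω ^ 2 ∂P = c) (hc : 0 < c) {s : ℝ} (hs : 0 ≤ s) :
    ∫ ω, Real.exp (-(s * Y ω ^ 2)) ∂P ≤ 2 / 3 + Real.exp (-(3 * s * c)) / 3 := by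
  have h4 := fourth_moment_le hY h2
  have hc' : (0 : ℝ) < c := hc
  obtain ⟨hi2, hi4⟩ := integrable_sq_and_pow_four hY
  set S : ℝ := 3 * s * c with hS
  have hS0 : 0 ≤ S := by positivity
  set κ := 1 - Real.exp (-S) * (1 + S) with hκ
  have hκ0 : 0 ≤ κ := by
    have h1 := Real.add_one_le_exp S
    have h3 : Real.exp (-S) * Real.exp S = 1 := by rw [← Real.exp_add]; simp
    nlinarith [mul_le_mul_of_nonneg_left h1 (Real.exp_pos (-S)).le]
  -- the parabola, expanded in powers of `Y`
  have hpt : ∀ ω, Real.exp (-(s * Y ω ^ 2)) ≤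
      (Real.exp (-S) * (1 + S) + κ) + (-(Real.exp (-S) * S + 2 * κ) / (3 * c)) * Y ω ^ 2 +
        (κ / (3 * c) ^ 2) * Y ω ^ 4 := by
    intro ω
    have h := exp_neg_mul_le_parabola hS0 (v := Y ω ^ 2 / (3 * c)) (by positivity)
    have h3 : S * (Y ω ^ 2 / (3 * c)) = s * Y ω ^ 2 := by rw [hS]; field_simp
    rw [h3] at h
    refine h.trans (le_of_eq ?_)
    rw [← hκ]
    field_simp
    ring
  have hint := integral_biquadratic hi2 hi4 (Real.exp (-S) * (1 + S) + κ)
    (-(Real.exp (-S) * S + 2 * κ) / (3 * c)) (κ / (3 * c) ^ 2)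
  have h5 := integral_mono_of_nonneg (Filter.Eventually.of_forall fun ω => (Real.exp_pos _).le)
    hint.1 (Filter.Eventually.of_forall hpt)
  refine h5.trans ?_
  rw [hint.2, h2]
  have h6 : κ / (3 * (c : ℝ)) ^ 2 * ∫ ω, Y ω ^ 4 ∂P ≤ κ / (3 * (c : ℝ)) ^ 2 * (3 * (c : ℝ) ^ 2) := by
    gcongr
  refine (add_le_add_right h6 _).trans (le_of_eq ?_)
  rw [hκ]
  field_simp
  ring

end

/-! ### Laplace transforms for one row and for all rows -/

section
variable {Ω : Type*} [MeasurableSpace Ω] {P : Measure Ω}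

/-- A strictly sub-Gaussian variable normalised to variance one. -/
structure IsUnitSubGaussian (X : Ω → ℝ) (P : Measure Ω) : Prop where
  measurable : Measurable X
  mean_eq_zero : ∫ ω, X ω ∂P = 0
  second_moment : ∫ ω, X ω ^ 2 ∂P = 1
  subGaussian : HasSubgaussianMGF X 1 P

lemma IsStrictlySubGaussian.isUnitSubGaussian {X : Ω → ℝ} {b : ℝ} (hb : 0 < b)
    (hX : IsStrictlySubGaussian X b P) : IsUnitSubGaussian (fun ω => √b * X ω) P where
  measurable := hX.measurable.const_mul _
  mean_eq_zero := by rw [integral_const_mul, hX.mean_eq_zero, mul_zero]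
  second_moment := by
    simp_rw [mul_pow, Real.sq_sqrt hb.le]
    rw [integral_const_mul, hX.second_moment]
    field_simp
  subGaussian :=
    { integrable_exp_mul := fun t => by simpa [mul_assoc] using hX.integrable_exp (t * √b)
      mgf_le := fun t => by
        have h := hX.exp_le (t * √b)
        simp only [mul_assoc] at h
        refine h.trans (le_of_eq ?_)
        congr 1
        rw [mul_pow, Real.sq_sqrt hb.le]
        simp only [NNReal.coe_one]
        field_simp }

variable {ι : Type*} [Fintype ι]

lemma IsUnitSubGaussian.hasSubgaussianMGF_sum {f : ι → Ω → ℝ} (hf : iIndepFun f P)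
    (hu : ∀ i, IsUnitSubGaussian (f i) P) (x : ι → ℝ) :
    HasSubgaussianMGF (fun ω => ∑ i, x i * f i ω) (∑ i, Real.toNNReal (x i ^ 2)) P := by
  refine HasSubgaussianMGF.sum_of_iIndepFun (X := fun i ω => x i * f i ω)
    (hf.comp (fun i y => x i * y) fun i => measurable_const_mul _) fun i _ => ?_
  refine ⟨fun t => ?_, fun t => ?_⟩
  · simpa [mul_assoc] using (hu i).subGaussian.integrable_exp_mul (t * x i)
  · have h := (hu i).subGaussian.mgf_le (t * x i)
    simp only [mgf, mul_assoc] at h ⊢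
    refine h.trans (le_of_eq ?_)
    rw [Real.coe_toNNReal _ (sq_nonneg _)]
    simp only [NNReal.coe_one]
    congr 1
    ring

lemma IsUnitSubGaussian.integral_sum_sq [IsProbabilityMeasure P] {f : ι → Ω → ℝ}
    (hf : iIndepFun f P) (hu : ∀ i, IsUnitSubGaussian (f i) P) (x : ι → ℝ) :
    ∫ ω, (∑ i, x i * f i ω) ^ 2 ∂P = ∑ i, x i ^ 2 := by
  have hm : ∀ i, MemLp (fun ω => x i * f i ω) 2 P := fun i =>
    ((hu i).subGaussian.memLp 2).const_mul _
  have h0 : ∀ i, ∫ ω, x i * f i ω ∂P = 0 := fun i => by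
    rw [integral_const_mul, (hu i).mean_eq_zero, mul_zero]
  have h1 := IndepFun.variance_sum (s := Finset.univ) (X := fun i ω => x i * f i ω)
    (fun i _ => hm i) fun i _ j _ hij =>
      (hf.indepFun hij).comp (measurable_const_mul (x i)) (measurable_const_mul (x j))
  have h2 : ∀ i, Var[fun ω => x i * f i ω; P] = x i ^ 2 := fun i => by
    rw [variance_of_integral_eq_zero (hm i).aemeasurable (h0 i)]
    simp_rw [mul_pow]
    rw [integral_const_mul, (hu i).second_moment, mul_one]
  rw [variance_of_integral_eq_zero] at h1
  · simpa [h2] using h1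
  · exact (Finset.aemeasurable_sum _ fun i _ => (hm i).aemeasurable)
  · simp only [Finset.sum_apply]
    rw [integral_finsetSum _ fun i _ => (hm i).integrable (by norm_num)]
    exact Finset.sum_eq_zero fun i _ => h0 i

lemma lintegral_exp_mul_le {V : Ω → ℝ} {c : NNReal} (hV : HasSubgaussianMGF V c P) (t : ℝ) :
    ∫⁻ ω, ENNReal.ofReal (Real.exp (t * V ω)) ∂P ≤ ENNReal.ofReal (Real.exp (c * t ^ 2 / 2)) := by
  rw [← ofReal_integral_eq_lintegral_ofReal (hV.integrable_exp_mul t)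
    (Filter.Eventually.of_forall fun ω => (Real.exp_pos _).le)]
  exact ENNReal.ofReal_le_ofReal (hV.mgf_le t)

/-- The linear forms with coefficients `x` and `u` of disjoint supports are independent.  Averaging
over the second one first leaves a Laplace transform of the square of the first one. -/
lemma lintegral_exp_row_le [IsProbabilityMeasure P] {f : ι → Ω → ℝ}
    (hf : iIndepFun f P) (hu : ∀ i, IsUnitSubGaussian (f i) P) (x u : ι → ℝ)
    (hxu : ∀ i, x i = 0 ∨ u i = 0) {μ b : ℝ} (hub : ∑ i, u i ^ 2 ≤ b)
    (hμ : 0 ≤ μ - μ ^ 2 * b / 2) (hx : 0 < ∑ i, x i ^ 2) :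
    ∫⁻ ω, ENNReal.ofReal (Real.exp (-(μ * ((∑ i, x i * f i ω) ^ 2 +
      (∑ i, x i * f i ω) * ∑ i, u i * f i ω)))) ∂P ≤
    ENNReal.ofReal (2 / 3 + Real.exp (-(3 * (μ - μ ^ 2 * b / 2) * ∑ i, x i ^ 2)) / 3) := by
  classical
  set Y : Ω → ℝ := fun ω => ∑ i, x i * f i ω with hY
  set V : Ω → ℝ := fun ω => ∑ i, u i * f i ω with hV
  have hfm : ∀ i, Measurable (f i) := fun i => (hu i).measurable
  have hYm : Measurable Y := by fun_prop
  have hVm : Measurable V := by fun_prop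
  set s := μ - μ ^ 2 * b / 2 with hs
  have hYs := IsUnitSubGaussian.hasSubgaussianMGF_sum hf hu x
  have hVs := IsUnitSubGaussian.hasSubgaussianMGF_sum hf hu u
  have hcoe : ∀ z : ι → ℝ, ((∑ i, Real.toNNReal (z i ^ 2) : NNReal) : ℝ) = ∑ i, z i ^ 2 := by
    intro z
    push_cast
    exact Finset.sum_congr rfl fun i _ => Real.coe_toNNReal _ (sq_nonneg _)
  have hind : IndepFun Y V P := by
    have h := hf.indepFun_finset (Finset.univ.filter fun i => x i ≠ 0)
      (Finset.univ.filter fun i => u i ≠ 0) (by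
        rw [Finset.disjoint_filter]
        intro i _ h1 h2
        exact (hxu i).elim h1 h2) hfm
    have h2 := h.comp
      (φ := fun g : (Finset.univ.filter fun i => x i ≠ 0) → ℝ => ∑ i, x i.1 * g i)
      (ψ := fun g : (Finset.univ.filter fun i => u i ≠ 0) → ℝ => ∑ i, u i.1 * g i)
      (by fun_prop) (by fun_prop)
    have hext : ∀ z : ι → ℝ, (fun ω => ∑ i, z i * f i ω) =
        fun ω => ∑ i : (Finset.univ.filter fun i => z i ≠ 0), z i * f i ω := by
      intro z
      ext ω
      rw [Finset.sum_coe_sort (Finset.univ.filter fun i => z i ≠ 0) (fun i => z i * f i ω)]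
      refine (Finset.sum_subset (Finset.filter_subset _ _) fun i _ hi => ?_).symm
      have : z i = 0 := by simpa using hi
      simp [this]
    rw [hY, hV, hext x, hext u]
    exact h2
  have hmeas : Measurable fun p : ℝ × ℝ =>
      ENNReal.ofReal (Real.exp (-(μ * (p.1 ^ 2 + p.1 * p.2)))) := by fun_prop
  have hprod := (indepFun_iff_map_prod_eq_prod_map_map hYm.aemeasurable hVm.aemeasurable).1 hind
  have hPY : IsProbabilityMeasure (P.map Y) := Measure.isProbabilityMeasure_map hYm.aemeasurable
  have hPV : IsProbabilityMeasure (P.map V) := Measure.isProbabilityMeasure_map hVm.aemeasurable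
  calc ∫⁻ ω, ENNReal.ofReal (Real.exp (-(μ * (Y ω ^ 2 + Y ω * V ω)))) ∂P
      = ∫⁻ p, ENNReal.ofReal (Real.exp (-(μ * (p.1 ^ 2 + p.1 * p.2))))
          ∂(P.map fun ω => (Y ω, V ω)) := by
        rw [lintegral_map hmeas (hYm.prodMk hVm)]
    _ = ∫⁻ y, ∫⁻ v, ENNReal.ofReal (Real.exp (-(μ * (y ^ 2 + y * v)))) ∂(P.map V) ∂(P.map Y) := by
        rw [hprod, lintegral_prod _ hmeas.aemeasurable]
    _ ≤ ∫⁻ y, ENNReal.ofReal (Real.exp (-(s * y ^ 2))) ∂(P.map Y) := by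
        refine lintegral_mono fun y => ?_
        have h1 : ∀ v, ENNReal.ofReal (Real.exp (-(μ * (y ^ 2 + y * v)))) =
            ENNReal.ofReal (Real.exp (-(μ * y ^ 2))) *
              ENNReal.ofReal (Real.exp ((-(μ * y)) * v)) := by
          intro v
          rw [← ENNReal.ofReal_mul (Real.exp_pos _).le, ← Real.exp_add]
          congr 2
          ring
        simp_rw [h1]
        rw [lintegral_const_mul _ (by fun_prop), lintegral_map (by fun_prop) hVm]
        refine (mul_le_mul_right (lintegral_exp_mul_le hVs _) _).trans ?_
        rw [← ENNReal.ofReal_mul (Real.exp_pos _).le, ← Real.exp_add, hcoe]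
        refine ENNReal.ofReal_le_ofReal (Real.exp_le_exp.2 ?_)
        have : (∑ i, u i ^ 2) * (μ * y) ^ 2 ≤ b * (μ * y) ^ 2 := by gcongr
        rw [hs]
        nlinarith
    _ = ENNReal.ofReal (∫ ω, Real.exp (-(s * Y ω ^ 2)) ∂P) := by
        rw [lintegral_map (by fun_prop) hYm, ofReal_integral_eq_lintegral_ofReal]
        · refine Integrable.of_bound (C := 1) (by fun_prop) (Filter.Eventually.of_forall fun ω => ?_)
          rw [Real.norm_eq_abs, abs_of_pos (Real.exp_pos _), Real.exp_le_one_iff]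
          have : 0 ≤ s * Y ω ^ 2 := by positivity
          linarith
        · exact Filter.Eventually.of_forall fun ω => (Real.exp_pos _).le
    _ ≤ _ := by
        refine ENNReal.ofReal_le_ofReal ?_
        have h := integral_exp_neg_mul_sq_le hYs
          (by rw [hcoe]; exact IsUnitSubGaussian.integral_sum_sq hf hu x)
          (by rw [← NNReal.coe_pos, hcoe]; exact hx) hμ
        rwa [hcoe] at h

/-- The rows of a matrix with independent entries are independent. -/
lemma iIndepFun_rows {κ : Type*} {m : ℕ} [IsProbabilityMeasure P] {G : Ω → Fin m → κ → ℝ}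
    (hG : iIndepFun (fun (p : Fin m × κ) ω => G ω p.1 p.2) P)
    (hm : ∀ r i, Measurable fun ω => G ω r i) :
    iIndepFun (fun r ω => G ω r) P := by
  have hrow : ∀ r, iIndepFun (fun i ω => G ω r i) P := fun r =>
    hG.precomp (g := fun i => (r, i)) fun i j h => (Prod.ext_iff.1 h).2
  have hrm : ∀ r, Measurable fun ω => G ω r := fun r => measurable_pi_lambda _ (hm r)
  have hpr : ∀ r i, IsProbabilityMeasure (P.map fun ω => G ω r i) := fun r i =>
    Measure.isProbabilityMeasure_map (hm r i).aemeasurable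
  have h1 : ∀ r, P.map (fun ω => G ω r) = Measure.infinitePi fun i => P.map fun ω => G ω r i :=
    fun r => (hrow r).map_fun_eq_infinitePi_map (hm r)
  have h2 := hG.map_fun_eq_infinitePi_map fun p : Fin m × κ => hm p.1 p.2
  rw [iIndepFun_iff_map_fun_eq_infinitePi_map hrm]
  simp_rw [h1]
  rw [← Measure.infinitePi_map_curry (fun r i => P.map fun ω => G ω r i), ← h2,
    Measure.map_map (MeasurableEquiv.measurable _)
      (measurable_pi_lambda _ fun p : Fin m × κ => hm p.1 p.2)]
  rfl

/-- The Laplace transform of `‖G x‖² + ⟨G x, G u⟩` for disjointly supported `x` and `u`. -/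
lemma lintegral_exp_matrix_le {m : ℕ} [IsProbabilityMeasure P] {G : Ω → Fin m → ι → ℝ}
    (hG : iIndepFun (fun (p : Fin m × ι) ω => G ω p.1 p.2) P)
    (hu : ∀ r i, IsUnitSubGaussian (fun ω => G ω r i) P) (x u : ι → ℝ)
    (hxu : ∀ i, x i = 0 ∨ u i = 0) {μ b : ℝ} (hub : ∑ i, u i ^ 2 ≤ b)
    (hμ : 0 ≤ μ - μ ^ 2 * b / 2) (hx : 0 < ∑ i, x i ^ 2) :
    ∫⁻ ω, ENNReal.ofReal (Real.exp (-(μ * ∑ r, ((∑ i, x i * G ω r i) ^ 2 +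
      (∑ i, x i * G ω r i) * ∑ i, u i * G ω r i)))) ∂P ≤
    ENNReal.ofReal
      ((2 / 3 + Real.exp (-(3 * (μ - μ ^ 2 * b / 2) * ∑ i, x i ^ 2)) / 3) ^ m) := by
  have hm : ∀ r i, Measurable fun ω => G ω r i := fun r i => (hu r i).measurable
  have hrows := (iIndepFun_rows hG hm).comp
    (fun _ g => ENNReal.ofReal (Real.exp (-(μ * ((∑ i, x i * g i) ^ 2 +
      (∑ i, x i * g i) * ∑ i, u i * g i))))) fun _ => by fun_prop
  have h1 : ∀ ω, ENNReal.ofReal (Real.exp (-(μ * ∑ r, ((∑ i, x i * G ω r i) ^ 2 +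
      (∑ i, x i * G ω r i) * ∑ i, u i * G ω r i)))) =
      ∏ r, ENNReal.ofReal (Real.exp (-(μ * ((∑ i, x i * G ω r i) ^ 2 +
      (∑ i, x i * G ω r i) * ∑ i, u i * G ω r i)))) := by
    intro ω
    rw [← ENNReal.ofReal_prod_of_nonneg fun r _ => (Real.exp_pos _).le, ← Real.exp_sum,
      Finset.sum_neg_distrib, Finset.mul_sum]
  simp_rw [h1]
  refine (lintegral_prod_eq_prod_lintegral_of_indepFun Finset.univ _ hrows fun r => ?_).trans_le ?_
  · have := hm r
    simp only [Function.comp_def]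
    fun_prop
  · refine (Finset.prod_le_prod' fun r _ => lintegral_exp_row_le
      (hG.precomp (g := fun i => (r, i)) fun i j h => (Prod.ext_iff.1 h).2) (hu r) x u hxu hub hμ
      hx).trans ?_
    rw [Finset.prod_const, Finset.card_univ, Fintype.card_fin, ENNReal.ofReal_pow]
    positivity

/-! ### Column norms -/

/-- Upper-tail Laplace transform, by Gaussian linearisation: `exp (2/7 y²)` is the average of
`exp (√(4/7) h y)` over a standard Gaussian `h`. -/
lemma lintegral_exp_sq_le [IsProbabilityMeasure P] {X : Ω → ℝ} (hX : IsUnitSubGaussian X P) :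
    ∫⁻ ω, ENNReal.ofReal (Real.exp (2 / 7 * X ω ^ 2)) ∂P ≤ ENNReal.ofReal (√(7 / 3)) := by
  have hlin : ∀ y : ℝ, ENNReal.ofReal (Real.exp (2 / 7 * y ^ 2)) =
      ∫⁻ h, ENNReal.ofReal (Real.exp (√(4 / 7) * h * y)) ∂(gaussianReal 0 1) := by
    intro y
    have h1 := congrFun (mgf_id_gaussianReal (μ := 0) (v := 1)) (√(4 / 7) * y)
    have h2 : √(4 / 7 : ℝ) ^ 2 = 4 / 7 := Real.sq_sqrt (by norm_num)
    have h3 : Integrable (fun h => Real.exp (√(4 / 7) * y * h)) (gaussianReal 0 1) :=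
      integrable_exp_mul_gaussianReal _
    simp only [mgf, id, zero_mul, NNReal.coe_one, one_mul, zero_add, mul_pow, h2] at h1
    have h4 : ∀ h : ℝ, √(4 / 7) * h * y = √(4 / 7) * y * h := fun h => by ring
    simp_rw [h4]
    rw [← ofReal_integral_eq_lintegral_ofReal h3
      (Filter.Eventually.of_forall fun h => (Real.exp_pos _).le), h1]
    congr 2
    ring
  have hXm := hX.measurable
  simp_rw [hlin]
  rw [lintegral_lintegral_swap (by fun_prop)]
  calc ∫⁻ h, ∫⁻ ω, ENNReal.ofReal (Real.exp (√(4 / 7) * h * X ω)) ∂P ∂(gaussianReal 0 1)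
      ≤ ∫⁻ h, ENNReal.ofReal (Real.exp (2 / 7 * h ^ 2)) ∂(gaussianReal 0 1) := by
        refine lintegral_mono fun h => (lintegral_exp_mul_le hX.subGaussian _).trans (le_of_eq ?_)
        rw [mul_pow, Real.sq_sqrt (by norm_num)]
        congr 2
        simp only [NNReal.coe_one]
        ring
    _ = ENNReal.ofReal (√(7 / 3)) := by
        rw [gaussianReal_of_var_ne_zero _ one_ne_zero,
          lintegral_withDensity_eq_lintegral_mul _ (measurable_gaussianPDF _ _) (by fun_prop)]
        have h1 : ∀ h : ℝ, (gaussianPDF 0 1 * fun h => ENNReal.ofReal (Real.exp (2 / 7 * h ^ 2))) h =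
            ENNReal.ofReal ((√(2 * Real.pi))⁻¹ * Real.exp (-(3 / 14) * h ^ 2)) := by
          intro h
          simp only [Pi.mul_apply, gaussianPDF, gaussianPDFReal]
          rw [← ENNReal.ofReal_mul (by positivity), mul_assoc, ← Real.exp_add]
          simp only [NNReal.coe_one, mul_one, sub_zero]
          congr 3
          ring
        simp_rw [h1]
        rw [← ofReal_integral_eq_lintegral_ofReal
          ((integrable_exp_neg_mul_sq (by norm_num)).const_mul _)
          (Filter.Eventually.of_forall fun h => by positivity), integral_const_mul,
          integral_gaussian]
        congr 1
        rw [← Real.sqrt_inv, ← Real.sqrt_mul (by positivity)]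
        congr 1
        field_simp
        norm_num

/-- Chernoff's bound for the squared norm of one column. -/
lemma measure_column_le {κ : Type*} {m : ℕ} [IsProbabilityMeasure P] {G : Ω → Fin m → κ → ℝ}
    (hG : iIndepFun (fun (p : Fin m × κ) ω => G ω p.1 p.2) P)
    (hu : ∀ r i, IsUnitSubGaussian (fun ω => G ω r i) P) (i : κ) :
    P {ω | 7 / 3 * (m : ℝ) < ∑ r, G ω r i ^ 2} ≤
      ENNReal.ofReal ((Real.exp (-(2 / 3)) * √(7 / 3)) ^ m) := by
  have hm : ∀ r i, Measurable fun ω => G ω r i := fun r i => (hu r i).measurable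
  have hcol : iIndepFun (fun r ω => G ω r i) P :=
    hG.precomp (g := fun r => (r, i)) fun r s h => (Prod.ext_iff.1 h).1
  have hcomp := hcol.comp (fun _ y => ENNReal.ofReal (Real.exp (2 / 7 * y ^ 2)))
    fun _ => by fun_prop
  have h1 : ∫⁻ ω, ENNReal.ofReal (Real.exp (2 / 7 * ∑ r, G ω r i ^ 2)) ∂P ≤
      ENNReal.ofReal (√(7 / 3) ^ m) := by
    have h2 : ∀ ω, ENNReal.ofReal (Real.exp (2 / 7 * ∑ r, G ω r i ^ 2)) =
        ∏ r, ENNReal.ofReal (Real.exp (2 / 7 * G ω r i ^ 2)) := by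
      intro ω
      rw [← ENNReal.ofReal_prod_of_nonneg fun r _ => (Real.exp_pos _).le, ← Real.exp_sum,
        Finset.mul_sum]
    simp_rw [h2]
    refine (lintegral_prod_eq_prod_lintegral_of_indepFun Finset.univ _ hcomp
      fun r => ?_).trans_le ?_
    · have := hm r i
      simp only [Function.comp_def]
      fun_prop
    · refine (Finset.prod_le_prod' fun r _ => lintegral_exp_sq_le (hu r i)).trans ?_
      rw [Finset.prod_const, Finset.card_univ, Fintype.card_fin, ENNReal.ofReal_pow]
      positivity
  have hmeas : Measurable fun ω => ENNReal.ofReal (Real.exp (2 / 7 * ∑ r, G ω r i ^ 2)) := by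
    fun_prop
  have hε0 : ENNReal.ofReal (Real.exp (2 / 3) ^ m) ≠ 0 := by
    simp only [ne_eq, ENNReal.ofReal_eq_zero, not_le]; positivity
  calc P {ω | 7 / 3 * (m : ℝ) < ∑ r, G ω r i ^ 2}
      ≤ P {ω | ENNReal.ofReal (Real.exp (2 / 3) ^ m) ≤
          ENNReal.ofReal (Real.exp (2 / 7 * ∑ r, G ω r i ^ 2))} := by
        refine measure_mono fun ω hω => ?_
        have hω' : 7 / 3 * (m : ℝ) < ∑ r, G ω r i ^ 2 := hω
        refine ENNReal.ofReal_le_ofReal ?_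
        rw [← Real.exp_nat_mul]
        exact Real.exp_le_exp.2 (by linarith)
    _ ≤ (∫⁻ ω, ENNReal.ofReal (Real.exp (2 / 7 * ∑ r, G ω r i ^ 2)) ∂P) /
          ENNReal.ofReal (Real.exp (2 / 3) ^ m) :=
        meas_ge_le_lintegral_div hmeas.aemeasurable hε0 ENNReal.ofReal_ne_top
    _ ≤ ENNReal.ofReal (√(7 / 3) ^ m) / ENNReal.ofReal (Real.exp (2 / 3) ^ m) := by gcongr
    _ = _ := by
        rw [← ENNReal.ofReal_div_of_pos (by positivity), ← div_pow, Real.exp_neg, div_eq_mul_inv,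
          mul_comm]
end

/-! ### A union bound over a ball without a net -/

section
variable {κ : Type*} [Fintype κ]

lemma setIntegral_ball_comp_isometry (F : EuclideanSpace ℝ κ ≃ₗᵢ[ℝ] EuclideanSpace ℝ κ)
    (f : EuclideanSpace ℝ κ → ℝ) (ρ : ℝ) :
    ∫ z in Metric.ball 0 ρ, f (F z) = ∫ z in Metric.ball 0 ρ, f z := by
  have h := F.measurePreserving.setIntegral_preimage_emb
    F.toHomeomorph.measurableEmbedding f (Metric.ball 0 ρ)
  rwa [F.preimage_ball, map_zero] at h

lemma integrableOn_ball_of_continuous {f : EuclideanSpace ℝ κ → ℝ} (hf : Continuous f) (ρ : ℝ) :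
    IntegrableOn f (Metric.ball 0 ρ) :=
  (hf.continuousOn.integrableOn_compact (isCompact_closedBall 0 ρ)).mono_set
    Metric.ball_subset_closedBall

lemma setIntegral_ball_mul_eq_zero {i j : κ} (hij : i ≠ j) (ρ : ℝ) :
    ∫ z : EuclideanSpace ℝ κ in Metric.ball 0 ρ, z i * z j = 0 := by
  classical
  have h := setIntegral_ball_comp_isometry (LinearIsometryEquiv.piLpCongrRight 2 fun l : κ =>
    if l = i then LinearIsometryEquiv.neg ℝ else LinearIsometryEquiv.refl ℝ ℝ)
    (fun z => z i * z j) ρ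
  simp only [LinearIsometryEquiv.piLpCongrRight_apply, if_true, if_neg hij.symm,
    LinearIsometryEquiv.coe_neg, LinearIsometryEquiv.coe_refl, id, neg_mul] at h
  rw [integral_neg] at h
  linarith

/-- The mean over a ball of a quadratic form `‖g z‖²` only involves the norms of the columns of
`g`, since the mixed moments of the coordinates vanish. -/
lemma setIntegral_ball_quadratic_le {m : ℕ} (g : Fin m → κ → ℝ) {β ρ : ℝ} (hβ : 0 ≤ β)
    (hg : ∀ i, ∑ r, g r i ^ 2 ≤ β) :
    ∫ z : EuclideanSpace ℝ κ in Metric.ball 0 ρ, ∑ r, (∑ i, z i * g r i) ^ 2 ≤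
      β * ρ ^ 2 * volume.real (Metric.ball (0 : EuclideanSpace ℝ κ) ρ) := by
  classical
  have hc : ∀ i j : κ, Continuous fun z : EuclideanSpace ℝ κ => z i * z j := fun i j => by fun_prop
  have h1 : ∀ z : EuclideanSpace ℝ κ, ∑ r, (∑ i, z i * g r i) ^ 2 =
      ∑ i, ∑ j, (∑ r, g r i * g r j) * (z i * z j) := by
    intro z
    simp_rw [sq, Finset.sum_mul_sum, Finset.sum_mul]
    rw [Finset.sum_comm]
    refine Finset.sum_congr rfl fun i _ => ?_
    rw [Finset.sum_comm]
    exact Finset.sum_congr rfl fun j _ => Finset.sum_congr rfl fun r _ => by ring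
  simp_rw [h1]
  rw [integral_finsetSum _ fun i _ => integrable_finsetSum _ fun j _ =>
    (integrableOn_ball_of_continuous (hc i j) ρ).const_mul _]
  have h2 : ∀ i, ∫ z : EuclideanSpace ℝ κ in Metric.ball 0 ρ,
      ∑ j, (∑ r, g r i * g r j) * (z i * z j) =
      (∑ r, g r i ^ 2) * ∫ z : EuclideanSpace ℝ κ in Metric.ball 0 ρ, z i * z i := by
    intro i
    rw [integral_finsetSum _ fun j _ => (integrableOn_ball_of_continuous (hc i j) ρ).const_mul _]
    simp_rw [integral_const_mul]
    rw [Finset.sum_eq_single i]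
    · simp_rw [sq]
    · intro j _ hj
      rw [setIntegral_ball_mul_eq_zero hj.symm, mul_zero]
    · simp
  simp_rw [h2]
  have h3 : ∀ i, 0 ≤ ∫ z : EuclideanSpace ℝ κ in Metric.ball 0 ρ, z i * z i := fun i =>
    integral_nonneg fun z => mul_self_nonneg _
  calc ∑ i, (∑ r, g r i ^ 2) * ∫ z : EuclideanSpace ℝ κ in Metric.ball 0 ρ, z i * z i
      ≤ ∑ i, β * ∫ z : EuclideanSpace ℝ κ in Metric.ball 0 ρ, z i * z i :=
        Finset.sum_le_sum fun i _ => mul_le_mul_of_nonneg_right (hg i) (h3 i)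
    _ = β * ∫ z : EuclideanSpace ℝ κ in Metric.ball 0 ρ, ‖z‖ ^ 2 := by
        rw [← Finset.mul_sum, ← integral_finsetSum _ fun i _ =>
          integrableOn_ball_of_continuous (hc i i) ρ]
        simp_rw [EuclideanSpace.real_norm_sq_eq, sq]
    _ ≤ β * ∫ z : EuclideanSpace ℝ κ in Metric.ball 0 ρ, ρ ^ 2 := by
        refine mul_le_mul_of_nonneg_left ?_ hβ
        refine setIntegral_mono_on (integrableOn_ball_of_continuous (by fun_prop) ρ)
          (integrableOn_ball_of_continuous (by fun_prop) ρ) measurableSet_ball fun z hz => ?_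
        exact pow_le_pow_left₀ (norm_nonneg z) (mem_ball_zero_iff.1 hz).le 2
    _ = _ := by
        rw [setIntegral_const, smul_eq_mul]; ring

/-- If the quadratic functional `‖g x‖² + ⟨g x, v⟩` is nonpositive at `x₀`, the integral of its
negative exponential over a small ball around `x₀` is large.  The linear terms average out over the
ball, so that the loss is of second order in the radius. -/
lemma le_lintegral_ball {m : ℕ} (g : Fin m → κ → ℝ) (v : Fin m → ℝ) {β ρ μ : ℝ} (hβ : 0 ≤ β)
    (hμ : 0 ≤ μ) (hg : ∀ i, ∑ r, g r i ^ 2 ≤ β) (x₀ : EuclideanSpace ℝ κ)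
    (hx₀ : ∑ r, ((∑ i, x₀ i * g r i) ^ 2 + (∑ i, x₀ i * g r i) * v r) ≤ 0) :
    volume (Metric.ball (0 : EuclideanSpace ℝ κ) ρ) * ENNReal.ofReal (Real.exp (-(μ * (β * ρ ^ 2))))
      ≤ ∫⁻ x in Metric.ball x₀ ρ, ENNReal.ofReal (Real.exp
        (-(μ * ∑ r, ((∑ i, x i * g r i) ^ 2 + (∑ i, x i * g r i) * v r)))) := by
  set Φ : EuclideanSpace ℝ κ → ℝ := fun x =>
    ∑ r, ((∑ i, x i * g r i) ^ 2 + (∑ i, x i * g r i) * v r) with hΦ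
  set B := Metric.ball (0 : EuclideanSpace ℝ κ) ρ with hB
  have hΦc : Continuous Φ := by fun_prop
  set q : EuclideanSpace ℝ κ → ℝ := fun z => ∑ r, (∑ i, z i * g r i) ^ 2 with hq
  set ℓ : EuclideanSpace ℝ κ → ℝ := fun z =>
    ∑ r, (∑ i, z i * g r i) * (2 * (∑ i, x₀ i * g r i) + v r) with hℓ
  have hqc : Continuous q := by fun_prop
  have hℓc : Continuous ℓ := by fun_prop
  have hexp : ∀ z, Φ (x₀ + z) = Φ x₀ + ℓ z + q z := by
    intro z
    simp only [hΦ, hq, hℓ, ← Finset.sum_add_distrib]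
    refine Finset.sum_congr rfl fun r _ => ?_
    simp only [PiLp.add_apply, add_mul, Finset.sum_add_distrib]
    ring
  have hℓ0 : ∫ z in B, ℓ z = 0 := by
    have h := setIntegral_ball_comp_isometry (LinearIsometryEquiv.neg ℝ) ℓ ρ
    have h1 : ∀ z, ℓ (LinearIsometryEquiv.neg ℝ z) = -ℓ z := by
      intro z
      simp [hℓ, Finset.sum_neg_distrib]
    simp_rw [h1] at h
    rw [integral_neg] at h
    linarith
  have hq0 : ∫ z in B, q z ≤ β * ρ ^ 2 * volume.real B := setIntegral_ball_quadratic_le g hβ hg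
  have hshift : ∫⁻ x in Metric.ball x₀ ρ, ENNReal.ofReal (Real.exp (-(μ * Φ x))) =
      ∫⁻ z in B, ENNReal.ofReal (Real.exp (-(μ * Φ (x₀ + z)))) := by
    have h := (measurePreserving_add_left volume x₀).setLIntegral_comp_preimage_emb
      (MeasurableEquiv.addLeft x₀).measurableEmbedding
      (fun x => ENNReal.ofReal (Real.exp (-(μ * Φ x)))) (Metric.ball x₀ ρ)
    rw [← h]
    congr 2
    ext z
    simp [hB, dist_eq_norm]
  rw [hshift, ← ofReal_integral_eq_lintegral_ofReal
    (integrableOn_ball_of_continuous (by fun_prop) ρ)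
    (Filter.Eventually.of_forall fun z => (Real.exp_pos _).le)]
  have hfin : volume B ≠ ⊤ := measure_ball_lt_top.ne
  rw [← ENNReal.ofReal_toReal hfin, ← ENNReal.ofReal_mul ENNReal.toReal_nonneg]
  refine ENNReal.ofReal_le_ofReal ?_
  change volume.real B * _ ≤ _
  -- the tangent line of the exponential at the mean of the exponent
  set τ := -(μ * (β * ρ ^ 2)) with hτ
  have htan : ∀ z, Real.exp τ * (1 + (-(μ * Φ (x₀ + z)) - τ)) ≤
      Real.exp (-(μ * Φ (x₀ + z))) := by
    intro z
    have h1 : Real.exp (-(μ * Φ (x₀ + z))) =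
        Real.exp τ * Real.exp (-(μ * Φ (x₀ + z)) - τ) := by
      rw [← Real.exp_add]; congr 1; ring
    rw [h1]
    exact mul_le_mul_of_nonneg_left (by linarith [Real.add_one_le_exp (-(μ * Φ (x₀ + z)) - τ)])
      (Real.exp_pos _).le
  have hmono := setIntegral_mono (μ := volume) (s := B)
    (integrableOn_ball_of_continuous (by fun_prop) ρ)
    (integrableOn_ball_of_continuous (by fun_prop) ρ) htan
  refine le_trans ?_ hmono
  rw [integral_const_mul, mul_comm]
  refine mul_le_mul_of_nonneg_left ?_ (Real.exp_pos _).le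
  have h2 : ∀ z, 1 + (-(μ * Φ (x₀ + z)) - τ) = (1 - μ * Φ x₀ - τ) + (-μ) * (ℓ z + q z) := by
    intro z
    rw [hexp]; ring
  simp_rw [h2]
  have hi : IntegrableOn (fun z => ℓ z + q z) B :=
    integrableOn_ball_of_continuous (by fun_prop) ρ
  rw [integral_add (integrableOn_ball_of_continuous (by fun_prop) ρ) (hi.const_mul _),
    integral_const_mul, integral_add (integrableOn_ball_of_continuous hℓc ρ)
      (integrableOn_ball_of_continuous hqc ρ), hℓ0, setIntegral_const, smul_eq_mul, zero_add]
  have hv : 0 ≤ volume.real B := measureReal_nonneg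
  have h3 : 0 ≤ volume.real B * (-(μ * Φ x₀)) :=
    mul_nonneg hv (by have := mul_nonpos_of_nonneg_of_nonpos hμ hx₀; linarith)
  have h4 : μ * ∫ z in B, q z ≤ μ * (β * ρ ^ 2 * volume.real B) :=
    mul_le_mul_of_nonneg_left hq0 hμ
  rw [hτ]
  linarith

end

section
variable {Ω : Type*} [MeasurableSpace Ω] {P : Measure Ω} {ι : Type*} [Fintype ι] [DecidableEq ι]

/-- For a fixed set `R` of coordinates and a fixed vector `u` supported off `R`, it is unlikely that
some unit vector `x` supported in `R` has `‖G x‖² + ⟨G x, G u⟩ ≤ 0`, unless some column is long.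
The exponential of `-μ` times the functional is integrated over an annulus around the unit sphere
of `ℝ^R`; the factor `11 ^ #R` is the ratio of the volumes of the balls of radii `11/10` and
`1/10`. -/
theorem measure_exists_unit_vector_le {m : ℕ} [IsProbabilityMeasure P] {G : Ω → Fin m → ι → ℝ}
    (hG : iIndepFun (fun (p : Fin m × ι) ω => G ω p.1 p.2) P)
    (hu : ∀ r i, IsUnitSubGaussian (fun ω => G ω r i) P) (R : Finset ι) (u : ι → ℝ)
    (huR : ∀ i ∈ R, u i = 0) {μ b : ℝ} (hub : ∑ i, u i ^ 2 ≤ b) (hμ0 : 0 ≤ μ)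
    (hμ : 0 ≤ μ - μ ^ 2 * b / 2) :
    P {ω | (∀ i, ∑ r, G ω r i ^ 2 ≤ 7 / 3 * m) ∧ ∃ x : EuclideanSpace ℝ R, ‖x‖ = 1 ∧
      ∑ r, ((∑ i, x i * G ω r i) ^ 2 + (∑ i, x i * G ω r i) * ∑ i, u i * G ω r i) ≤ 0} ≤
    ENNReal.ofReal (11 ^ R.card * (Real.exp (7 / 300 * μ) *
      (2 / 3 + Real.exp (-(3 * (μ - μ ^ 2 * b / 2) * (81 / 100))) / 3)) ^ m) := by
  have hm : ∀ r i, Measurable fun ω => G ω r i := fun r i => (hu r i).measurable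
  set s := μ - μ ^ 2 * b / 2 with hs
  set f : Ω → EuclideanSpace ℝ R → ENNReal := fun ω x => ENNReal.ofReal (Real.exp
    (-(μ * ∑ r, ((∑ i, x i * G ω r i) ^ 2 + (∑ i, x i * G ω r i) * ∑ i, u i * G ω r i))))
    with hf
  have hfm : Measurable (Function.uncurry f) := by
    have h1 : ∀ r i, Measurable fun p : Ω × EuclideanSpace ℝ R => G p.1 r i := fun r i =>
      (hm r i).comp measurable_fst
    have h2 : ∀ i : R, Measurable fun p : Ω × EuclideanSpace ℝ R => p.2 i := fun i => by fun_prop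
    simp only [hf, Function.uncurry_def]
    fun_prop
  set S : Set (EuclideanSpace ℝ R) := Metric.ball 0 (11 / 10) ∩ {x | 9 / 10 ≤ ‖x‖} with hS
  have hSm : MeasurableSet S :=
    measurableSet_ball.inter (measurableSet_le measurable_const measurable_norm)
  set E : ℝ := 2 / 3 + Real.exp (-(3 * s * (81 / 100))) / 3 with hE
  have hE0 : 0 < E := by positivity
  set V := volume (Metric.ball (0 : EuclideanSpace ℝ R) 1) with hV
  have hV0 : V ≠ 0 := (Metric.measure_ball_pos volume _ one_pos).ne'
  have hVt : V ≠ ⊤ := measure_ball_lt_top.ne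
  have hball : ∀ ρ : ℝ, 0 < ρ → volume (Metric.ball (0 : EuclideanSpace ℝ R) ρ) =
      ENNReal.ofReal (ρ ^ R.card) * V := by
    intro ρ hρ
    rw [Measure.addHaar_ball_of_pos _ _ hρ, finrank_euclideanSpace, Fintype.card_coe]
  have hpt : ∀ x ∈ S, ∫⁻ ω, f ω x ∂P ≤ ENNReal.ofReal (E ^ m) := by
    intro x hx
    set x' : ι → ℝ := fun i => if h : i ∈ R then x ⟨i, h⟩ else 0 with hx'
    have hsum : ∀ c : ι → ℝ, ∑ i, x' i * c i = ∑ i : R, x i * c i := by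
      intro c
      rw [← Finset.sum_subset (Finset.subset_univ R) fun i _ hi => by simp [hx', hi],
        ← Finset.sum_coe_sort R]
      exact Finset.sum_congr rfl fun i _ => by simp [hx']
    have hsq : ∑ i, x' i ^ 2 = ‖x‖ ^ 2 := by
      simp_rw [sq (x' _)]
      rw [hsum, EuclideanSpace.real_norm_sq_eq]
      exact Finset.sum_congr rfl fun i _ => by simp [hx', sq]
    have hnorm : 81 / 100 ≤ ‖x‖ ^ 2 := by
      have : 9 / 10 ≤ ‖x‖ := hx.2
      nlinarith
    have h := lintegral_exp_matrix_le hG hu x' u (fun i => by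
      by_cases hi : i ∈ R
      · exact Or.inr (huR i hi)
      · exact Or.inl (by simp [hx', hi])) hub hμ (by rw [hsq]; linarith)
    simp_rw [hsum, hsq] at h
    refine h.trans (ENNReal.ofReal_le_ofReal (pow_le_pow_left₀ (by positivity) ?_ m))
    have : 3 * s * (81 / 100) ≤ 3 * s * ‖x‖ ^ 2 := by gcongr
    rw [hE]
    gcongr
  have hint : ∫⁻ ω, (∫⁻ x in S, f ω x) ∂P ≤ ENNReal.ofReal ((11 / 10) ^ R.card * E ^ m) * V := by
    rw [lintegral_lintegral_swap hfm.aemeasurable]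
    calc ∫⁻ x in S, ∫⁻ ω, f ω x ∂P ≤ ∫⁻ _ in S, ENNReal.ofReal (E ^ m) :=
          setLIntegral_mono measurable_const hpt
      _ = ENNReal.ofReal (E ^ m) * volume S := by rw [setLIntegral_const]
      _ ≤ ENNReal.ofReal (E ^ m) * volume (Metric.ball (0 : EuclideanSpace ℝ R) (11 / 10)) := by
          gcongr; exact Set.inter_subset_left
      _ = _ := by
          rw [hball _ (by norm_num), ENNReal.ofReal_mul (by positivity)]
          ring
  set δ : ENNReal := ENNReal.ofReal ((1 / 10) ^ R.card *
    Real.exp (-(μ * (7 / 3 * m * (1 / 10) ^ 2)))) * V with hδ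
  have hδ0 : δ ≠ 0 := mul_ne_zero
    (by simp only [ne_eq, ENNReal.ofReal_eq_zero, not_le]; positivity) hV0
  have hδt : δ ≠ ⊤ := ENNReal.mul_ne_top ENNReal.ofReal_ne_top hVt
  calc P {ω | (∀ i, ∑ r, G ω r i ^ 2 ≤ 7 / 3 * m) ∧ ∃ x : EuclideanSpace ℝ R, ‖x‖ = 1 ∧
      ∑ r, ((∑ i, x i * G ω r i) ^ 2 + (∑ i, x i * G ω r i) * ∑ i, u i * G ω r i) ≤ 0}
      ≤ P {ω | δ ≤ ∫⁻ x in S, f ω x} := by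
        refine measure_mono fun ω hω => ?_
        obtain ⟨hcol, x₀, hx₀, hbad⟩ := hω
        have h := le_lintegral_ball (ρ := 1 / 10) (fun r (i : R) => G ω r i)
          (fun r => ∑ i, u i * G ω r i) (β := 7 / 3 * m) (by positivity) hμ0
          (fun i => hcol i) x₀ hbad
        rw [hball _ (by norm_num), mul_right_comm, ← ENNReal.ofReal_mul (by positivity)] at h
        refine h.trans (lintegral_mono_set fun x hx => ⟨?_, ?_⟩)
        · rw [mem_ball_zero_iff]
          rw [mem_ball_iff_norm] at hx
          have := norm_le_norm_add_norm_sub' x x₀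
          linarith
        · rw [mem_ball_iff_norm] at hx
          have := norm_le_norm_add_norm_sub' x₀ x
          rw [norm_sub_rev] at this
          change 9 / 10 ≤ ‖x‖
          linarith
    _ ≤ (∫⁻ ω, (∫⁻ x in S, f ω x) ∂P) / δ :=
        meas_ge_le_lintegral_div hfm.lintegral_prod_right'.aemeasurable hδ0 hδt
    _ ≤ (ENNReal.ofReal ((11 / 10) ^ R.card * E ^ m) * V) / δ := by gcongr
    _ = _ := by
        rw [hδ, ENNReal.mul_div_mul_right _ _ hV0 hVt, ← ENNReal.ofReal_div_of_pos (by positivity)]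
        congr 1
        rw [mul_pow (Real.exp _), ← Real.exp_nat_mul, Real.exp_neg]
        have h1 : μ * (7 / 3 * m * (1 / 10) ^ 2) = m * (7 / 300 * μ) := by ring
        rw [h1, show (11 : ℝ) = 11 / 10 / (1 / 10) by norm_num, div_pow]
        field_simp
        rw [← mul_pow]
        norm_num
end

/-! ### Kernel vectors violating the null space property -/

/-- Among the weights `r` with `0 ≤ r ≤ τ` and total mass at most `N τ`, the sum `∑ f r` is largest
when the mass sits on the `N` largest values of `f`. -/
lemma exists_subset_card_eq_sum_mul_le {α : Type*} [DecidableEq α] (D : Finset α) {N : ℕ}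
    (hN : N ≤ D.card) (f r : α → ℝ) (hf : ∀ i, 0 ≤ f i) {τ : ℝ} (hr0 : ∀ i ∈ D, 0 ≤ r i)
    (hrτ : ∀ i ∈ D, r i ≤ τ) (hr : ∑ i ∈ D, r i ≤ N * τ) :
    ∃ T ⊆ D, T.card = N ∧ ∑ i ∈ D, f i * r i ≤ τ * ∑ i ∈ T, f i := by
  obtain ⟨T, hT, hmax⟩ := Finset.exists_max_image (D.powersetCard N) (fun T => ∑ i ∈ T, f i)
    (Finset.powersetCard_nonempty.2 hN)
  obtain ⟨hTD, hTN⟩ := Finset.mem_powersetCard.1 hT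
  refine ⟨T, hTD, hTN, ?_⟩
  have hswap : ∀ i ∈ T, ∀ j ∈ D \ T, f j ≤ f i := by
    intro i hi j hj
    obtain ⟨hjD, hjT⟩ := Finset.mem_sdiff.1 hj
    have hji : j ∉ T.erase i := fun h => hjT (Finset.mem_of_mem_erase h)
    have h := hmax (insert j (T.erase i)) (Finset.mem_powersetCard.2
      ⟨Finset.insert_subset hjD ((Finset.erase_subset _ _).trans hTD), by
        rw [Finset.card_insert_of_notMem hji, Finset.card_erase_of_mem hi, hTN]
        have := Finset.card_pos.2 ⟨i, hi⟩
        omega⟩)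
    rw [Finset.sum_insert hji] at h
    have := Finset.add_sum_erase T f hi
    linarith
  rcases T.eq_empty_or_nonempty with rfl | hne
  · have hN0 : N = 0 := by simpa using hTN.symm
    subst hN0
    have h0 : ∑ i ∈ D, r i = 0 := le_antisymm (by simpa using hr) (Finset.sum_nonneg hr0)
    have h1 := (Finset.sum_eq_zero_iff_of_nonneg hr0).1 h0
    rw [Finset.sum_eq_zero fun i hi => by rw [h1 i hi, mul_zero]]
    simp
  · obtain ⟨i₀, hi₀, hmin⟩ := Finset.exists_min_image T f hne
    have h1 : ∑ i ∈ D \ T, f i * r i ≤ f i₀ * ∑ i ∈ D \ T, r i := by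
      rw [Finset.mul_sum]
      exact Finset.sum_le_sum fun j hj =>
        mul_le_mul_of_nonneg_right (hswap i₀ hi₀ j hj) (hr0 j (Finset.mem_sdiff.1 hj).1)
    have h2 := Finset.sum_sdiff (f := r) hTD
    have h3 := Finset.sum_sdiff (f := fun i => f i * r i) hTD
    have h4 : f i₀ * ∑ i ∈ D \ T, r i ≤ f i₀ * ∑ i ∈ T, (τ - r i) := by
      refine mul_le_mul_of_nonneg_left ?_ (hf i₀)
      rw [Finset.sum_sub_distrib, Finset.sum_const, hTN, nsmul_eq_mul]
      linarith
    have h5 : f i₀ * ∑ i ∈ T, (τ - r i) ≤ ∑ i ∈ T, f i * (τ - r i) := by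
      rw [Finset.mul_sum]
      exact Finset.sum_le_sum fun i hi =>
        mul_le_mul_of_nonneg_right (hmin i hi) (sub_nonneg.2 (hrτ i (hTD hi)))
    have h6 : ∑ i ∈ T, f i * (τ - r i) = τ * ∑ i ∈ T, f i - ∑ i ∈ T, f i * r i := by
      rw [Finset.mul_sum, ← Finset.sum_sub_distrib]
      exact Finset.sum_congr rfl fun i _ => by ring
    linarith

/-- The vector with entries `τ` on `T \ N`, `-τ` on `T ∩ N`, and zero off `T`. -/
def signedIndicator {ι : Type*} [DecidableEq ι] (τ : ℝ) (T N : Finset ι) (i : ι) : ℝ :=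
  if i ∈ T then (if i ∈ N then -τ else τ) else 0

lemma sum_signedIndicator_sq {ι : Type*} [Fintype ι] [DecidableEq ι] (τ : ℝ) (T N : Finset ι) :
    ∑ i, signedIndicator τ T N i ^ 2 = T.card * τ ^ 2 := by
  have : ∀ i, signedIndicator τ T N i ^ 2 = if i ∈ T then τ ^ 2 else 0 := by
    intro i
    unfold signedIndicator
    split_ifs <;> ring
  simp_rw [this]
  rw [Finset.sum_ite_mem, Finset.univ_inter, Finset.sum_const, nsmul_eq_mul]

/-- A failure of the null space property is witnessed by finitely supported data.  Let `w` be a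
kernel vector violating it, `T₁` the set of its large entries off `J`, and `x` the normalised part
of `w` on `J ∪ T₁`.  The remaining entries are small and have small sum, so that their contribution
to `⟨A x, A w⟩ = 0` is dominated by that of a vector with `M - #T₁` entries `±1 / (t M)`. -/
theorem exists_of_not_nullSpaceProperty {m n : ℕ} {A : Matrix (Fin m) (Fin n) ℝ}
    {J : Finset (Fin n)} {t : ℝ} (ht : 0 < t) (hA : ¬ NullSpaceProperty A J t) {M : ℕ}
    (hM0 : 0 < M) (hM : M ≤ Jᶜ.card) :
    ∃ T ∈ Jᶜ.powersetCard M, ∃ T₁ ∈ T.powerset, ∃ N ∈ (T \ T₁).powerset,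
      ∃ x : EuclideanSpace ℝ (J ∪ T₁ : Finset (Fin n)), ‖x‖ = 1 ∧
      ∑ r, ((∑ i, x i * A r i) ^ 2 +
        (∑ i, x i * A r i) * ∑ i, signedIndicator (1 / (t * M)) (T \ T₁) N i * A r i) ≤ 0 := by
  unfold NullSpaceProperty at hA
  push Not at hA
  obtain ⟨w, hw, hlt⟩ := hA
  have hMpos : (0 : ℝ) < M := by exact_mod_cast hM0
  set τ : ℝ := 1 / (t * M) with hτ
  have hτ0 : 0 < τ := by positivity
  set a := √(∑ j ∈ J, w j ^ 2) with ha
  have ha0 : 0 < a := lt_of_le_of_lt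
    (mul_nonneg ht.le (Finset.sum_nonneg fun j _ => abs_nonneg _)) hlt
  have hl1 : ∑ j ∈ Jᶜ, |w j| < M * (τ * a) := by
    have h1 : (M : ℝ) * (τ * a) = a / t := by rw [hτ]; field_simp
    rw [h1, lt_div_iff₀ ht]; linarith
  set T₁ := Jᶜ.filter fun i => τ * a < |w i| with hT₁
  have hT₁J : T₁ ⊆ Jᶜ := Finset.filter_subset _ _
  have hT₁s : T₁.card * (τ * a) ≤ ∑ j ∈ T₁, |w j| := by
    rw [← nsmul_eq_mul]
    exact Finset.card_nsmul_le_sum _ _ _ fun i hi => (Finset.mem_filter.1 hi).2.le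
  have hT₁M : T₁.card < M := by
    have h1 : ∑ j ∈ T₁, |w j| ≤ ∑ j ∈ Jᶜ, |w j| :=
      Finset.sum_le_sum_of_subset_of_nonneg hT₁J fun j _ _ => abs_nonneg _
    have h2 : (T₁.card : ℝ) * (τ * a) < M * (τ * a) := by linarith
    exact_mod_cast lt_of_mul_lt_mul_right h2 (by positivity)
  set R := J ∪ T₁ with hR
  have hRc : Rᶜ = Jᶜ \ T₁ := by
    ext i; simp [hR]
  have hRcard : M - T₁.card ≤ Rᶜ.card := by
    rw [hRc, Finset.card_sdiff_of_subset hT₁J]; omega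
  set y : Fin m → ℝ := fun r => ∑ i ∈ R, w i * A r i with hy
  set φ : Fin n → ℝ := fun i => ∑ r, y r * A r i with hφ
  obtain ⟨T₂, hT₂, hT₂c, hsum⟩ := exists_subset_card_eq_sum_mul_le Rᶜ hRcard (fun i => |φ i|)
    (fun i => |w i|) (fun i => abs_nonneg _) (τ := τ * a) (fun i _ => abs_nonneg _)
    (fun i hi => by
      rw [hRc, Finset.mem_sdiff] at hi
      by_contra hcon
      exact hi.2 (Finset.mem_filter.2 ⟨hi.1, not_le.1 hcon⟩))
    (by
      have h1 := Finset.sum_sdiff (f := fun i => |w i|) hT₁J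
      rw [hRc, Nat.cast_sub hT₁M.le]
      nlinarith)
  have hdisj : Disjoint T₁ T₂ := by
    rw [Finset.disjoint_left]
    intro i h1 h2
    have := hT₂ h2
    rw [hRc] at this
    exact (Finset.mem_sdiff.1 this).2 h1
  have hTsub : T₂ ⊆ Jᶜ := fun i hi => by
    have := hT₂ hi
    rw [hRc] at this
    exact (Finset.mem_sdiff.1 this).1
  have hT12 : (T₁ ∪ T₂) \ T₁ = T₂ := by
    rw [Finset.union_sdiff_left, Finset.sdiff_eq_self_of_disjoint hdisj.symm]
  refine ⟨T₁ ∪ T₂, Finset.mem_powersetCard.2 ⟨Finset.union_subset hT₁J hTsub, ?_⟩, T₁,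
    Finset.mem_powerset.2 Finset.subset_union_left, T₂.filter fun i => 0 < φ i, ?_, ?_⟩
  · rw [Finset.card_union_of_disjoint hdisj, hT₂c]; omega
  · rw [hT12]; exact Finset.mem_powerset.2 (Finset.filter_subset _ _)
  rw [hT12]
  set u := signedIndicator τ T₂ (T₂.filter fun i => 0 < φ i) with hu
  have huφ : ∑ i, u i * φ i = -(τ * ∑ i ∈ T₂, |φ i|) := by
    have h1 : ∀ i, u i * φ i = if i ∈ T₂ then -(τ * |φ i|) else 0 := by
      intro i
      by_cases hi : i ∈ T₂
      · by_cases hp : 0 < φ i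
        · simp [hu, signedIndicator, hi, hp, abs_of_pos hp]
        · simp [hu, signedIndicator, hi, hp, abs_of_nonpos (not_lt.1 hp)]
      · simp [hu, signedIndicator, hi]
    simp_rw [h1]
    rw [Finset.sum_ite_mem, Finset.univ_inter, Finset.sum_neg_distrib, Finset.mul_sum]
  have hyu : ∑ r, y r * ∑ i, u i * A r i = ∑ i, u i * φ i := by
    simp only [hφ, Finset.mul_sum]
    rw [Finset.sum_comm]
    exact Finset.sum_congr rfl fun i _ => Finset.sum_congr rfl fun r _ => by ring
  -- the vanishing inner product `⟨A w_R, A w⟩`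
  have hzero : ∑ r, y r ^ 2 + ∑ i ∈ Rᶜ, w i * φ i = 0 := by
    have h1 : ∀ r, y r + ∑ i ∈ Rᶜ, w i * A r i = 0 := by
      intro r
      have := congrFun hw r
      simp only [Matrix.mulVec, dotProduct, Pi.zero_apply] at this
      rw [hy, Finset.sum_add_sum_compl, ← this]
      exact Finset.sum_congr rfl fun i _ => mul_comm _ _
    have h2 : ∑ i ∈ Rᶜ, w i * φ i = ∑ r, y r * ∑ i ∈ Rᶜ, w i * A r i := by
      simp only [hφ, Finset.mul_sum]
      rw [Finset.sum_comm]
      exact Finset.sum_congr rfl fun i _ => Finset.sum_congr rfl fun r _ => by ring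
    rw [h2, ← Finset.sum_add_distrib]
    refine Finset.sum_eq_zero fun r _ => ?_
    linear_combination y r * h1 r
  have hmain : ∑ r, y r ^ 2 + a * ∑ r, y r * ∑ i, u i * A r i ≤ 0 := by
    have h1 : -∑ i ∈ Rᶜ, |φ i| * |w i| ≤ ∑ i ∈ Rᶜ, w i * φ i := by
      rw [← Finset.sum_neg_distrib]
      refine Finset.sum_le_sum fun i _ => ?_
      rw [mul_comm, ← abs_mul]
      exact neg_abs_le _
    rw [hyu, huφ]
    nlinarith
  -- normalisation
  set ν := √(∑ i ∈ R, w i ^ 2) with hν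
  have haν : a ≤ ν := Real.sqrt_le_sqrt (Finset.sum_le_sum_of_subset_of_nonneg
    Finset.subset_union_left fun i _ _ => sq_nonneg _)
  have hν0 : 0 < ν := ha0.trans_le haν
  refine ⟨WithLp.toLp 2 fun i => w i / ν, ?_, ?_⟩
  · rw [EuclideanSpace.norm_eq]
    simp only [Real.norm_eq_abs, sq_abs, div_pow]
    rw [← Finset.sum_div, Finset.sum_coe_sort R (fun i => w i ^ 2), hν, Real.sq_sqrt
      (Finset.sum_nonneg fun i _ => sq_nonneg _), div_self, Real.sqrt_one]
    intro h0
    rw [hν, h0, Real.sqrt_zero] at hν0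
    exact lt_irrefl _ hν0
  · have h1 : ∀ r, ∑ i : R, w i / ν * A r i = y r / ν := by
      intro r
      rw [Finset.sum_coe_sort R (fun i => w i / ν * A r i), hy, Finset.sum_div]
      exact Finset.sum_congr rfl fun i _ => by ring
    have h2 : ∑ r, ((y r / ν) ^ 2 + y r / ν * ∑ i, u i * A r i) =
        (∑ r, y r ^ 2) / ν ^ 2 + (∑ r, y r * ∑ i, u i * A r i) / ν := by
      rw [Finset.sum_div, Finset.sum_div, ← Finset.sum_add_distrib]
      exact Finset.sum_congr rfl fun r _ => by ring
    have h4 : ∑ r, ((∑ i : R, w i / ν * A r i) ^ 2 +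
        (∑ i : R, w i / ν * A r i) * ∑ i, u i * A r i) =
        ∑ r, ((y r / ν) ^ 2 + y r / ν * ∑ i, u i * A r i) :=
      Finset.sum_congr rfl fun r _ => by rw [h1]
    refine le_of_eq_of_le (h4.trans h2) ?_
    set Y := ∑ r, y r ^ 2 with hY
    set I := ∑ r, y r * ∑ i, u i * A r i with hI
    have hY0 : 0 ≤ Y := Finset.sum_nonneg fun r _ => sq_nonneg _
    have h3 : Y / ν ^ 2 + I / ν = (Y + ν * I) / ν ^ 2 := by field_simp
    rw [h3]
    refine div_nonpos_of_nonpos_of_nonneg ?_ (sq_nonneg _)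
    -- `I ≤ - Y / a ≤ 0`, hence enlarging `a` to `ν` keeps the sum nonpositive
    have hI0 : I ≤ 0 := by
      by_contra hcon
      have := mul_pos ha0 (not_le.1 hcon)
      linarith
    have := mul_le_mul_of_nonpos_right haν hI0
    linarith

/-! ### Numerical constants -/

lemma le_exp_of_pow_le {y q : ℝ} (p N : ℕ) (hN : N ≠ 0) (hq : q * N = p)
    (h : y ^ N ≤ 2.7182818283 ^ p) : y ≤ Real.exp q := by
  refine le_of_pow_le_pow_left₀ hN (Real.exp_pos _).le ?_
  rw [← Real.exp_nat_mul, mul_comm, hq, ← mul_one (p : ℝ), Real.exp_nat_mul]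
  exact h.trans (pow_le_pow_left₀ (by norm_num) Real.exp_one_gt_d9.le p)

lemma exp_le_of_le_pow {y q : ℝ} (p N : ℕ) (hN : N ≠ 0) (hq : q * N = p) (hy : 0 ≤ y)
    (h : 2.7182818286 ^ p ≤ y ^ N) : Real.exp q ≤ y := by
  refine le_of_pow_le_pow_left₀ hN hy ?_
  rw [← Real.exp_nat_mul, mul_comm, hq, ← mul_one (p : ℝ), Real.exp_nat_mul]
  exact (pow_le_pow_left₀ (Real.exp_pos 1).le Real.exp_one_lt_d9.le p).trans h

lemma column_base_le : Real.exp (-(2 / 3)) * √(7 / 3) ≤ Real.exp (-0.239) := by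
  have h1 : √(7 / 3) ≤ Real.exp 0.425 := by
    rw [Real.sqrt_le_left (Real.exp_pos _).le, ← Real.exp_nat_mul]
    exact le_exp_of_pow_le 17 20 (by norm_num) (by norm_num) (by norm_num)
  calc Real.exp (-(2 / 3)) * √(7 / 3) ≤ Real.exp (-(2 / 3)) * Real.exp 0.425 := by gcongr
    _ = Real.exp (-(2 / 3) + 0.425) := by rw [Real.exp_add]
    _ ≤ _ := Real.exp_le_exp.2 (by norm_num)

lemma sparse_base_le : Real.exp (7 / 300 * (6 / 5)) * (2 / 3 + Real.exp (-(3 *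
    (6 / 5 - (6 / 5) ^ 2 * (5 / 6) / 2) * (81 / 100))) / 3) ≤ Real.exp (-0.25) := by
  have h1 : (4 : ℝ) ≤ Real.exp 1.4 := le_exp_of_pow_le 7 5 (by norm_num) (by norm_num) (by norm_num)
  have h2 : Real.exp 0.28 ≤ 4 / 3 :=
    exp_le_of_le_pow 7 25 (by norm_num) (by norm_num) (by norm_num) (by norm_num)
  have h3 : Real.exp (-(3 * (6 / 5 - (6 / 5) ^ 2 * (5 / 6) / 2) * (81 / 100))) ≤ 1 / 4 := by
    calc _ ≤ Real.exp (-1.4) := Real.exp_le_exp.2 (by norm_num)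
      _ = (Real.exp 1.4)⁻¹ := Real.exp_neg _
      _ ≤ _ := by rw [one_div]; gcongr
  calc _ ≤ Real.exp 0.03 * (2 / 3 + 1 / 4 / 3) := by
        gcongr; norm_num
    _ = Real.exp (-0.25) * (Real.exp 0.28 * (3 / 4)) := by
        rw [← mul_assoc, ← Real.exp_add]; norm_num
    _ ≤ Real.exp (-0.25) * 1 := by gcongr; linarith
    _ = _ := mul_one _

lemma full_base_le : Real.exp (7 / 300 * 2) * (2 / 3 + Real.exp (-(3 *
    (2 - 2 ^ 2 * 0 / 2) * (81 / 100))) / 3) ≤ Real.exp (-0.35) := by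
  have h1 : (100 : ℝ) ≤ Real.exp 4.8 :=
    le_exp_of_pow_le 24 5 (by norm_num) (by norm_num) (by norm_num)
  have h2 : Real.exp 0.4 ≤ 100 / 67 :=
    exp_le_of_le_pow 2 5 (by norm_num) (by norm_num) (by norm_num) (by norm_num)
  have h3 : Real.exp (-(3 * (2 - 2 ^ 2 * 0 / 2) * (81 / 100))) ≤ 1 / 100 := by
    calc _ ≤ Real.exp (-4.8) := Real.exp_le_exp.2 (by norm_num)
      _ = (Real.exp 4.8)⁻¹ := Real.exp_neg _
      _ ≤ _ := by rw [one_div]; gcongr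
  calc _ ≤ Real.exp 0.05 * (2 / 3 + 1 / 100 / 3) := by
        gcongr; norm_num
    _ = Real.exp (-0.35) * (Real.exp 0.4 * (67 / 100)) := by
        rw [← mul_assoc, ← Real.exp_add]; norm_num
    _ ≤ Real.exp (-0.35) * 1 := by gcongr; linarith
    _ = _ := mul_one _

lemma eleven_le_exp : (11 : ℝ) ≤ Real.exp 2.4 :=
  le_exp_of_pow_le 12 5 (by norm_num) (by norm_num) (by norm_num)

lemma thirteen_le_exp : (13 : ℝ) ≤ Real.exp 2.6 :=
  le_exp_of_pow_le 13 5 (by norm_num) (by norm_num) (by norm_num)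

lemma le_log_of_six_le {r : ℝ} (hr : 6 ≤ r) : 1.75 ≤ Real.log r := by
  rw [Real.le_log_iff_exp_le (by linarith)]
  exact (exp_le_of_le_pow 7 4 (by norm_num) (by norm_num) (by norm_num) (by norm_num)).trans hr

lemma le_four_mul_log {r : ℝ} (h2 : 2 ≤ r) (h6 : r ≤ 6) : r ≤ 4 * Real.log r := by
  have hl2 := Real.log_two_gt_d9
  have hr : 0 < r := by linarith
  have key : ∀ c : ℝ, 0 < c → Real.log c + (1 - c / r) ≤ Real.log r := by
    intro c hc
    have h := Real.one_sub_inv_le_log_of_pos (div_pos hr hc)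
    rw [Real.log_div hr.ne' hc.ne', inv_div] at h
    linarith
  rcases le_total r 4 with h4 | h4
  · have h := key 2 (by norm_num)
    have h1 : 2 / r ≤ 0.693 + 1 - r / 4 := by
      rw [div_le_iff₀ hr]; nlinarith
    linarith
  · have h := key 4 (by norm_num)
    have h5 : Real.log 4 = 2 * Real.log 2 := by
      rw [show (4 : ℝ) = 2 ^ 2 by norm_num, Real.log_pow]; norm_num
    have h1 : 4 / r ≤ 1.386 + 1 - r / 4 := by
      rw [div_le_iff₀ hr]; nlinarith
    linarith

/-- `binom n r ≤ (e n / r) ^ r`. -/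
lemma choose_le_exp_pow {n r : ℕ} (hr : 0 < r) :
    (n.choose r : ℝ) ≤ (Real.exp 1 * n / r) ^ r := by
  have h1 : (n.choose r : ℝ) ≤ (n : ℝ) ^ r / r.factorial := Nat.choose_le_pow_div r n
  have h2 : (r : ℝ) ^ r / r.factorial ≤ Real.exp r := Real.pow_div_factorial_le_exp _ (by positivity) r
  have hf : (0 : ℝ) < r.factorial := by exact_mod_cast r.factorial_pos
  have hr' : (0 : ℝ) < r := by exact_mod_cast hr
  rw [div_pow, mul_pow, ← Real.exp_nat_mul, mul_one]
  refine h1.trans ?_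
  rw [div_le_div_iff₀ hf (by positivity)]
  rw [div_le_iff₀ hf] at h2
  have : (n : ℝ) ^ r * (r : ℝ) ^ r ≤ (n : ℝ) ^ r * (Real.exp r * r.factorial) := by gcongr
  linarith

/-! ### The null space property of a random matrix -/

section
variable {Ω : Type*} [MeasurableSpace Ω] {P : Measure Ω}

lemma measure_exists_long_column_le {m n k : ℕ} [IsProbabilityMeasure P]
    {G : Ω → Fin m → Fin n → ℝ}
    (hG : iIndepFun (fun (p : Fin m × Fin n) ω => G ω p.1 p.2) P)
    (hu : ∀ r i, IsUnitSubGaussian (fun ω => G ω r i) P) (hk : 0 < k) (hkn : 2 * k ≤ n) :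
    P {ω | ∃ i, 7 / 3 * (m : ℝ) < ∑ r, G ω r i ^ 2} ≤
      ENNReal.ofReal (Real.exp (-0.239 * m + 6.7 * k * Real.log (n / k))) := by
  have hk' : (0 : ℝ) < k := by exact_mod_cast hk
  have hk1 : (1 : ℝ) ≤ k := by exact_mod_cast hk
  have hkn' : (2 : ℝ) * k ≤ n := by exact_mod_cast hkn
  have hn' : (0 : ℝ) < n := by linarith
  set L := Real.log (n / k) with hL
  have hL2 : 0.69 ≤ L := by
    have h1 : Real.log 2 ≤ L := Real.log_le_log (by norm_num) (by rw [le_div_iff₀ hk']; linarith)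
    linarith [Real.log_two_gt_d9]
  have hn : (n : ℝ) ≤ Real.exp (6.7 * k * L) := by
    have h1 : Real.log n = Real.log k + L := by
      rw [hL, Real.log_div hn'.ne' hk'.ne']; ring
    rw [← Real.log_le_iff_le_exp hn', h1]
    have h2 := Real.log_le_sub_one_of_pos hk'
    nlinarith
  have hset : {ω | ∃ i, 7 / 3 * (m : ℝ) < ∑ r, G ω r i ^ 2} =
      ⋃ i, {ω | 7 / 3 * (m : ℝ) < ∑ r, G ω r i ^ 2} := by ext; simp
  rw [hset]
  calc P (⋃ i, {ω | 7 / 3 * (m : ℝ) < ∑ r, G ω r i ^ 2})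
      ≤ ∑ i, P {ω | 7 / 3 * (m : ℝ) < ∑ r, G ω r i ^ 2} := measure_iUnion_fintype_le _ _
    _ ≤ ∑ _i : Fin n, ENNReal.ofReal (Real.exp (-0.239 * m)) := by
        refine Finset.sum_le_sum fun i _ => (measure_column_le hG hu i).trans ?_
        refine ENNReal.ofReal_le_ofReal ?_
        rw [mul_comm (-0.239 : ℝ), Real.exp_nat_mul]
        exact pow_le_pow_left₀ (by positivity) column_base_le m
    _ = ENNReal.ofReal (n * Real.exp (-0.239 * m)) := by
        rw [Finset.sum_const, Finset.card_univ, Fintype.card_fin, nsmul_eq_mul,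
          ENNReal.ofReal_mul hn'.le, ENNReal.ofReal_natCast]
    _ ≤ _ := by
        refine ENNReal.ofReal_le_ofReal ?_
        rw [add_comm, Real.exp_add]
        gcongr

/-- For `n` at most `6 k` the whole matrix is injective with high probability. -/
lemma measure_not_nullSpaceProperty_le_of_le {m n k : ℕ} [IsProbabilityMeasure P]
    {G : Ω → Fin m → Fin n → ℝ}
    (hG : iIndepFun (fun (p : Fin m × Fin n) ω => G ω p.1 p.2) P)
    (hu : ∀ r i, IsUnitSubGaussian (fun ω => G ω r i) P) (hk : 0 < k) (hkn : 2 * k ≤ n)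
    (hn6 : n ≤ 6 * k) (hm : 28.1 * k * Real.log (n / k) ≤ m) {J : Finset (Fin n)} {t : ℝ} :
    P {ω | (∀ i, ∑ r, G ω r i ^ 2 ≤ 7 / 3 * m) ∧ ¬ NullSpaceProperty (Matrix.of (G ω)) J t} ≤
      ENNReal.ofReal (Real.exp (-0.239 * m + 6.7 * k * Real.log (n / k))) := by
  have hk' : (0 : ℝ) < k := by exact_mod_cast hk
  have hkn' : (2 : ℝ) * k ≤ n := by exact_mod_cast hkn
  have hn6' : (n : ℝ) ≤ 6 * k := by exact_mod_cast hn6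
  have h4 := le_four_mul_log (r := (n : ℝ) / k) (by rw [le_div_iff₀ hk']; linarith)
    (by rw [div_le_iff₀ hk']; linarith)
  set L := Real.log (n / k) with hL
  rw [div_le_iff₀ hk'] at h4
  have h := measure_exists_unit_vector_le hG hu Finset.univ (fun _ => 0) (fun _ _ => rfl)
    (μ := 2) (b := 0) (by simp) (by norm_num) (by norm_num)
  refine (measure_mono fun ω hω => ?_).trans (h.trans (ENNReal.ofReal_le_ofReal ?_))
  · obtain ⟨hcol, hnsp⟩ := hω
    refine ⟨hcol, ?_⟩
    unfold NullSpaceProperty at hnsp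
    push Not at hnsp
    obtain ⟨w, hw, hlt⟩ := hnsp
    have hw0 : w ≠ 0 := by
      rintro rfl
      simp at hlt
    set ν := √(∑ i, w i ^ 2) with hν
    have hpos : 0 < ∑ i, w i ^ 2 := by
      refine lt_of_le_of_ne (Finset.sum_nonneg fun i _ => sq_nonneg _) fun h0 => hw0 ?_
      ext i
      simpa using (Finset.sum_eq_zero_iff_of_nonneg fun i _ => sq_nonneg _).1 h0.symm i
        (Finset.mem_univ i)
    refine ⟨WithLp.toLp 2 fun i => w i / ν, ?_, ?_⟩
    · rw [EuclideanSpace.norm_eq]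
      simp only [Real.norm_eq_abs, sq_abs, div_pow]
      rw [← Finset.sum_div, Finset.sum_coe_sort Finset.univ (fun i => w i ^ 2), hν,
        Real.sq_sqrt hpos.le, div_self hpos.ne', Real.sqrt_one]
    · refine le_of_eq (Finset.sum_eq_zero fun r _ => ?_)
      have h1 : ∑ i : (Finset.univ : Finset (Fin n)), w i / ν * G ω r i = 0 := by
        rw [Finset.sum_coe_sort Finset.univ (fun i => w i / ν * G ω r i)]
        have h2 := congrFun hw r
        simp only [Matrix.mulVec, dotProduct, Matrix.of_apply, Pi.zero_apply] at h2
        have h3 : ∀ i, w i / ν * G ω r i = G ω r i * w i / ν := fun i => by ring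
        simp_rw [h3]
        rw [← Finset.sum_div, h2, zero_div]
      rw [h1]
      ring
  · rw [Finset.card_univ, Fintype.card_fin]
    calc (11 : ℝ) ^ n * _ ^ m ≤ Real.exp 2.4 ^ n * Real.exp (-0.35) ^ m := by
          gcongr
          · exact eleven_le_exp
          · exact full_base_le
      _ = Real.exp (n * 2.4 + m * (-0.35)) := by
          rw [Real.exp_add, Real.exp_nat_mul, Real.exp_nat_mul]
      _ ≤ _ := Real.exp_le_exp.2 (by nlinarith)

lemma choose_two_mul_le {n k : ℕ} (hk : 0 < k) (hn : 0 < n) :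
    (n.choose (2 * k) : ℝ) ≤ Real.exp (2 * k * (0.307 + Real.log (n / k))) := by
  have hk' : (0 : ℝ) < k := by exact_mod_cast hk
  have hn' : (0 : ℝ) < n := by exact_mod_cast hn
  have h1 : Real.exp 1 * n / (2 * k : ℕ) = Real.exp (1 - Real.log 2 + Real.log (n / k)) := by
    rw [Real.exp_add, Real.exp_sub, Real.exp_log (by norm_num), Real.exp_log (by positivity)]
    push_cast
    field_simp
  calc (n.choose (2 * k) : ℝ) ≤ (Real.exp 1 * n / (2 * k : ℕ)) ^ (2 * k) :=
        choose_le_exp_pow (by omega)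
    _ = Real.exp (2 * k * (1 - Real.log 2 + Real.log (n / k))) := by
        rw [h1, ← Real.exp_nat_mul]; push_cast; ring_nf
    _ ≤ _ := by
        gcongr
        linarith [Real.log_two_gt_d9]

/-- The total cost of the union bound over the sets `T₁ ⊆ T` and the signs on `T \ T₁`. -/
lemma sum_powerset_le {m n k : ℕ} (hk : 0 < k) (hn6 : 6 * k ≤ n)
    (hm : 28.1 * k * Real.log (n / k) ≤ m) {U : Finset (Fin n)} (hU : U.card ≤ n) {E : ℝ}
    (hE0 : 0 ≤ E) (hE : E ≤ Real.exp (-0.25)) :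
    ∑ T ∈ U.powersetCard (2 * k), ∑ T₁ ∈ T.powerset, ∑ _N ∈ (T \ T₁).powerset,
      (11 ^ k * E ^ m * 11 ^ T₁.card : ℝ) ≤
      Real.exp (-0.239 * m + 6.7 * k * Real.log (n / k)) := by
  have hk' : (0 : ℝ) < k := by exact_mod_cast hk
  have hn6' : (6 : ℝ) * k ≤ n := by exact_mod_cast hn6
  have hL2 := le_log_of_six_le (r := (n : ℝ) / k) (by rw [le_div_iff₀ hk']; linarith)
  -- each element of `T` costs `11` if it lies in `T₁` and `2`, for its sign, otherwise
  have h1 : ∀ T ∈ U.powersetCard (2 * k), ∑ T₁ ∈ T.powerset, ∑ _N ∈ (T \ T₁).powerset,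
      (11 ^ k * E ^ m * 11 ^ T₁.card : ℝ) = 11 ^ k * E ^ m * 13 ^ (2 * k) := by
    intro T hT
    have hTc := (Finset.mem_powersetCard.1 hT).2
    have h2 := Finset.sum_pow_mul_eq_add_pow (11 : ℝ) 2 T
    rw [show (11 : ℝ) + 2 = 13 by norm_num, hTc] at h2
    rw [← h2, Finset.mul_sum]
    refine Finset.sum_congr rfl fun T₁ hT₁ => ?_
    rw [Finset.sum_const, Finset.card_powerset,
      Finset.card_sdiff_of_subset (Finset.mem_powerset.1 hT₁), hTc, nsmul_eq_mul]
    push_cast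
    ring
  rw [Finset.sum_congr rfl h1, Finset.sum_const, Finset.card_powersetCard, nsmul_eq_mul]
  have hch : (U.card.choose (2 * k) : ℝ) ≤
      Real.exp (2 * k * (0.307 + Real.log (n / k))) :=
    le_trans (by exact_mod_cast Nat.choose_le_choose _ hU)
      (choose_two_mul_le hk (by omega))
  calc (U.card.choose (2 * k) : ℝ) * (11 ^ k * E ^ m * 13 ^ (2 * k))
      ≤ Real.exp (2 * k * (0.307 + Real.log (n / k))) *
        (Real.exp 2.4 ^ k * Real.exp (-0.25) ^ m * Real.exp 2.6 ^ (2 * k)) := by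
        gcongr
        · exact eleven_le_exp
        · exact thirteen_le_exp
    _ = Real.exp (2 * k * (0.307 + Real.log (n / k)) +
        (k * 2.4 + m * (-0.25) + (2 * k : ℕ) * 2.6)) := by
        rw [Real.exp_add, Real.exp_add, Real.exp_add, Real.exp_nat_mul, Real.exp_nat_mul,
          Real.exp_nat_mul]
    _ ≤ _ := by
        refine Real.exp_le_exp.2 ?_
        push_cast
        have := mul_le_mul_of_nonneg_left hL2 hk'.le
        nlinarith

/-- For `n` at least `6 k`, a union bound over the finitely supported data of
`exists_of_not_nullSpaceProperty` with `M = 2 k`. -/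
lemma measure_not_nullSpaceProperty_le_of_ge {m n k : ℕ} [IsProbabilityMeasure P]
    {G : Ω → Fin m → Fin n → ℝ}
    (hG : iIndepFun (fun (p : Fin m × Fin n) ω => G ω p.1 p.2) P)
    (hu : ∀ r i, IsUnitSubGaussian (fun ω => G ω r i) P) (hk : 0 < k)
    (hn6 : 6 * k ≤ n) (hm : 28.1 * k * Real.log (n / k) ≤ m) {J : Finset (Fin n)}
    (hJ : J.card = k) :
    P {ω | (∀ i, ∑ r, G ω r i ^ 2 ≤ 7 / 3 * m) ∧
        ¬ NullSpaceProperty (Matrix.of (G ω)) J √(3 / (5 * k))} ≤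
      ENNReal.ofReal (Real.exp (-0.239 * m + 6.7 * k * Real.log (n / k))) := by
  have hk' : (0 : ℝ) < k := by exact_mod_cast hk
  set t := √(3 / (5 * (k : ℝ))) with ht
  have ht0 : 0 < t := Real.sqrt_pos.2 (by positivity)
  have ht2 : t ^ 2 = 3 / (5 * k) := Real.sq_sqrt (by positivity)
  obtain ⟨E, hE⟩ : ∃ E, E = Real.exp (7 / 300 * (6 / 5)) * (2 / 3 + Real.exp (-(3 *
    (6 / 5 - (6 / 5) ^ 2 * (5 / 6) / 2) * (81 / 100))) / 3) := ⟨_, rfl⟩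
  have hJc : Jᶜ.card = n - k := by rw [Finset.card_compl, Fintype.card_fin, hJ]
  obtain ⟨bad, hbad_def⟩ : ∃ bad : Finset (Fin n) → Finset (Fin n) → Finset (Fin n) → Set Ω,
      ∀ T T₁ N, bad T T₁ N = {ω | (∀ i, ∑ r, G ω r i ^ 2 ≤ 7 / 3 * m) ∧
      ∃ x : EuclideanSpace ℝ (J ∪ T₁ : Finset (Fin n)), ‖x‖ = 1 ∧
      ∑ r, ((∑ i, x i * G ω r i) ^ 2 + (∑ i, x i * G ω r i) *
        ∑ i, signedIndicator (1 / (t * (2 * k : ℕ))) (T \ T₁) N i * G ω r i) ≤ 0} :=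
    ⟨_, fun _ _ _ => rfl⟩
  have hbad : ∀ T ∈ Jᶜ.powersetCard (2 * k), ∀ T₁ ∈ T.powerset, ∀ N ∈ (T \ T₁).powerset,
      P (bad T T₁ N) ≤ ENNReal.ofReal (11 ^ k * E ^ m * 11 ^ T₁.card) := by
    intro T hT T₁ hT₁ N _
    obtain ⟨hTJ, hTc⟩ := Finset.mem_powersetCard.1 hT
    have hT₁T := Finset.mem_powerset.1 hT₁
    rw [hbad_def]
    refine (measure_exists_unit_vector_le hG hu (J ∪ T₁) _ (fun i hi => ?_)
      (μ := 6 / 5) (b := 5 / 6) ?_ (by norm_num) (by norm_num)).trans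
      (ENNReal.ofReal_le_ofReal (le_of_eq ?_))
    · have : i ∉ T \ T₁ := by
        intro h
        obtain ⟨h1, h2⟩ := Finset.mem_sdiff.1 h
        rcases Finset.mem_union.1 hi with h3 | h3
        · exact Finset.mem_compl.1 (hTJ h1) h3
        · exact h2 h3
      simp [signedIndicator, this]
    · rw [sum_signedIndicator_sq]
      have h1 : ((T \ T₁).card : ℝ) ≤ 2 * k := by
        have := Finset.card_le_card (Finset.sdiff_subset (s := T) (t := T₁))
        rw [hTc] at this
        exact_mod_cast this
      calc ((T \ T₁).card : ℝ) * (1 / (t * (2 * k : ℕ))) ^ 2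
          ≤ 2 * k * (1 / (t * (2 * k : ℕ))) ^ 2 := by gcongr
        _ = 5 / 6 := by
          push_cast
          rw [div_pow, mul_pow, ht2]
          field_simp
          norm_num
    · have hdis : Disjoint J T₁ := by
        rw [Finset.disjoint_left]
        intro i hi hi'
        exact Finset.mem_compl.1 (hTJ (hT₁T hi')) hi
      rw [← hE, Finset.card_union_of_disjoint hdis, hJ, pow_add]
      ring
  have hcover : {ω | (∀ i, ∑ r, G ω r i ^ 2 ≤ 7 / 3 * m) ∧
      ¬ NullSpaceProperty (Matrix.of (G ω)) J t} ⊆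
      ⋃ T ∈ Jᶜ.powersetCard (2 * k), ⋃ T₁ ∈ T.powerset, ⋃ N ∈ (T \ T₁).powerset,
        bad T T₁ N := by
    intro ω hω
    obtain ⟨T, hT, T₁, hT₁, N, hN, hx⟩ := exists_of_not_nullSpaceProperty ht0 hω.2
      (M := 2 * k) (by omega) (by omega)
    refine Set.mem_biUnion hT (Set.mem_biUnion hT₁ (Set.mem_biUnion hN ?_))
    rw [hbad_def]
    exact ⟨hω.1, hx⟩
  have hE0 : 0 ≤ E := by rw [hE]; positivity
  have hnn : ∀ c : ℕ, 0 ≤ 11 ^ k * E ^ m * 11 ^ c := fun c => by positivity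
  calc P {ω | (∀ i, ∑ r, G ω r i ^ 2 ≤ 7 / 3 * m) ∧ ¬ NullSpaceProperty (Matrix.of (G ω)) J t}
      ≤ ∑ T ∈ Jᶜ.powersetCard (2 * k), ∑ T₁ ∈ T.powerset, ∑ N ∈ (T \ T₁).powerset,
          ENNReal.ofReal (11 ^ k * E ^ m * 11 ^ T₁.card) := by
        refine (measure_mono hcover).trans ((measure_biUnion_finset_le _ _).trans ?_)
        refine Finset.sum_le_sum fun T hT => (measure_biUnion_finset_le _ _).trans ?_
        refine Finset.sum_le_sum fun T₁ hT₁ => (measure_biUnion_finset_le _ _).trans ?_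
        exact Finset.sum_le_sum fun N hN => hbad T hT T₁ hT₁ N hN
    _ = ENNReal.ofReal (∑ T ∈ Jᶜ.powersetCard (2 * k), ∑ T₁ ∈ T.powerset,
          ∑ N ∈ (T \ T₁).powerset, 11 ^ k * E ^ m * 11 ^ T₁.card) := by
        rw [ENNReal.ofReal_sum_of_nonneg fun T _ => Finset.sum_nonneg fun T₁ _ =>
          Finset.sum_nonneg fun N _ => hnn _]
        refine Finset.sum_congr rfl fun T _ => ?_
        rw [ENNReal.ofReal_sum_of_nonneg fun T₁ _ => Finset.sum_nonneg fun N _ => hnn _]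
        refine Finset.sum_congr rfl fun T₁ _ => ?_
        rw [ENNReal.ofReal_sum_of_nonneg fun N _ => hnn _]
    _ ≤ _ := ENNReal.ofReal_le_ofReal <|
        sum_powerset_le hk hn6 hm (by rw [hJc]; omega) hE0 (hE.trans_le sparse_base_le)

/-- The constant `t² = 3 / (5 k)` is the one for which the null space properties of two matrices can
be combined in `kroneckerL1Solutions_eq_singleton`. -/
theorem measure_not_nullSpaceProperty_le {m n k : ℕ} [IsProbabilityMeasure P]
    {G : Ω → Fin m → Fin n → ℝ}
    (hG : iIndepFun (fun (p : Fin m × Fin n) ω => G ω p.1 p.2) P)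
    (hu : ∀ r i, IsUnitSubGaussian (fun ω => G ω r i) P) (hk : 0 < k) (hkn : 2 * k ≤ n)
    (hm : 28.1 * k * Real.log (n / k) ≤ m) {J : Finset (Fin n)} (hJ : J.card = k) :
    P {ω | ¬ NullSpaceProperty (Matrix.of (G ω)) J √(3 / (5 * k))} ≤
      ENNReal.ofReal (2 * Real.exp (-0.239 * m + 6.7 * k * Real.log (n / k))) := by
  have h1 := measure_exists_long_column_le hG hu hk hkn
  have h2 : P {ω | (∀ i, ∑ r, G ω r i ^ 2 ≤ 7 / 3 * m) ∧
        ¬ NullSpaceProperty (Matrix.of (G ω)) J √(3 / (5 * k))} ≤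
      ENNReal.ofReal (Real.exp (-0.239 * m + 6.7 * k * Real.log (n / k))) := by
    rcases le_total n (6 * k) with h | h
    · exact measure_not_nullSpaceProperty_le_of_le hG hu hk hkn h hm
    · exact measure_not_nullSpaceProperty_le_of_ge hG hu hk h hm hJ
  rw [two_mul, ENNReal.ofReal_add (Real.exp_pos _).le (Real.exp_pos _).le]
  refine le_trans (measure_mono fun ω hω => ?_) ((measure_union_le _ _).trans (add_le_add h1 h2))
  by_cases hc : ∃ i, 7 / 3 * (m : ℝ) < ∑ r, G ω r i ^ 2
  · exact Or.inl hc
  · push Not at hc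
    exact Or.inr ⟨hc, hω⟩

/-- The null space property of a matrix with independent strictly sub-Gaussian entries of variance
`1 / b`; rescaling the matrix does not change its kernel. -/
theorem measure_not_nullSpaceProperty_le_of_isStrictlySubGaussian {m n k : ℕ}
    [IsProbabilityMeasure P] {B : Ω → Matrix (Fin m) (Fin n) ℝ} {b : ℝ} (hb : 0 < b)
    (hB : ∀ i j, IsStrictlySubGaussian (fun ω => B ω i j) b P)
    (hind : iIndepFun (fun (p : Fin m × Fin n) ω => B ω p.1 p.2) P)
    (hk : 0 < k) (hkn : 2 * k ≤ n) {C : ℝ} (hC : 28.1 < C)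
    (hm : C * k * Real.log ((n : ℝ) / k) ≤ m) {J : Finset (Fin n)} (hJ : J.card = k) :
    P {ω | ¬ NullSpaceProperty (B ω) J √(3 / (5 * k))} ≤
      ENNReal.ofReal (2 * Real.exp (-(0.239 - 6.7 / C) * m)) := by
  have hk' : (0 : ℝ) < k := by exact_mod_cast hk
  have hkn' : (2 : ℝ) * k ≤ n := by exact_mod_cast hkn
  have hC0 : 0 < C := by linarith
  set L := Real.log ((n : ℝ) / k) with hL
  have hL0 : 0 ≤ L := Real.log_nonneg (by rw [le_div_iff₀ hk']; linarith)
  have h := measure_not_nullSpaceProperty_le (G := fun ω i j => √b * B ω i j)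
    (hind.comp (fun _ y => √b * y) fun _ => measurable_const_mul _)
    (fun i j => (hB i j).isUnitSubGaussian hb) hk hkn
    (le_trans (by gcongr) hm) hJ
  refine (measure_mono fun ω hω => ?_).trans (h.trans (ENNReal.ofReal_le_ofReal ?_))
  · refine fun hn => hω fun w hw => hn w ?_
    ext i
    have := congrFun hw i
    simp only [Matrix.mulVec, dotProduct, Pi.zero_apply] at this
    simp only [Matrix.mulVec, dotProduct, Matrix.of_apply, Pi.zero_apply, mul_assoc]
    rw [← Finset.mul_sum, this, mul_zero]
  · have h1 : k * L ≤ m / C := by rw [le_div_iff₀ hC0]; linarith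
    have h2 : (-(0.239 - 6.7 / C) * m : ℝ) = -0.239 * m + 6.7 * (m / C) := by ring
    rw [h2]
    have h3 : 6.7 * k * L ≤ 6.7 * (m / C) := by linarith
    exact mul_le_mul_of_nonneg_left (Real.exp_le_exp.2 (by linarith)) (by norm_num)

end

theorem theorem1 {Ω : Type*} [MeasurableSpace Ω] (P : Measure Ω) [IsProbabilityMeasure P]
    (m₁ n₁ m₂ n₂ k : ℕ)
    -- the signal is sparse relative to each of the two dimensions
    (hk₁ : 2 * k ≤ n₁) (hk₂ : 2 * k ≤ n₂)
    -- the random sensing matrices: all entries independent, strictly sub-Gaussian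
    (A : Ω → Matrix (Fin m₁) (Fin n₁) ℝ) (B : Ω → Matrix (Fin m₂) (Fin n₂) ℝ)
    (a b : ℝ) (ha : 0 < a) (hb : 0 < b)
    (hA : ∀ i j, IsStrictlySubGaussian (fun ω => A ω i j) a P)
    (hB : ∀ i j, IsStrictlySubGaussian (fun ω => B ω i j) b P)
    (hAB : iIndepFun
      (Sum.elim (fun (p : Fin m₁ × Fin n₁) (ω : Ω) => A ω p.1 p.2)
        (fun (p : Fin m₂ × Fin n₂) (ω : Ω) => B ω p.1 p.2)) P)
    (C : ℝ) (hC : 28.1 < C)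
    (hm₁ : C * k * Real.log ((n₁ : ℝ) / k) ≤ m₁)
    (hm₂ : C * k * Real.log ((n₂ : ℝ) / k) ≤ m₂)
    (X₀ : Matrix (Fin n₁) (Fin n₂) ℝ) (hX₀ : matrixL0 X₀ ≤ k) :
    1 - 2 * Real.exp (-(0.239 - 6.7 / C) * m₁) - 2 * Real.exp (-(0.239 - 6.7 / C) * m₂) ≤
      P.real {ω | kroneckerL1Solutions (A ω) (B ω) (A ω * X₀ * (B ω).transpose) = {X₀}} := by
  classical
  set S := {ij : Fin n₁ × Fin n₂ | X₀ ij.1 ij.2 ≠ 0}.toFinset with hS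
  have hSc : S.card ≤ k := by
    rw [hS, ← Set.ncard_eq_toFinset_card']; exact hX₀
  have hmem : ∀ i j, X₀ i j ≠ 0 → (i, j) ∈ S := fun i j h => by simpa [hS] using h
  set good := {ω | kroneckerL1Solutions (A ω) (B ω) (A ω * X₀ * (B ω).transpose) = {X₀}} with hgood
  rcases Nat.eq_zero_or_pos k with rfl | hk
  · -- the zero matrix is the only matrix of `ℓ¹`-norm at most zero
    have h0 : X₀ = 0 := by
      ext i j
      by_contra h
      have := Finset.card_pos.2 ⟨_, hmem i j h⟩
      omega
    have hall : good = Set.univ := by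
      ext ω
      simp only [hgood, Set.mem_ofPred_eq, Set.mem_univ, iff_true]
      ext W
      simp only [kroneckerL1Solutions, Set.mem_ofPred_eq, Set.mem_singleton_iff, h0,
        Matrix.mul_zero, Matrix.zero_mul]
      have hnn : ∀ Z : Matrix (Fin n₁) (Fin n₂) ℝ, 0 ≤ matrixL1 Z := fun Z =>
        Finset.sum_nonneg fun i _ => Finset.sum_nonneg fun j _ => abs_nonneg _
      have hz : matrixL1 (0 : Matrix (Fin n₁) (Fin n₂) ℝ) = 0 := by simp [matrixL1]
      constructor
      · rintro ⟨-, h2⟩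
        have h3 : matrixL1 W = 0 := le_antisymm ((h2 0 (by simp)).trans hz.le) (hnn W)
        ext i j
        have h4 := (Finset.sum_eq_zero_iff_of_nonneg fun i _ =>
          Finset.sum_nonneg fun j _ => abs_nonneg _).1 h3 i (Finset.mem_univ i)
        simpa using (Finset.sum_eq_zero_iff_of_nonneg fun j _ => abs_nonneg _).1 h4 j
          (Finset.mem_univ j)
      · rintro rfl
        exact ⟨by simp, fun Z _ => hz.le.trans (hnn Z)⟩
    rw [hall, probReal_univ]
    linarith [Real.exp_pos (-(0.239 - 6.7 / C) * m₁), Real.exp_pos (-(0.239 - 6.7 / C) * m₂)]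
  -- enlarge the sets of rows and columns meeting the support to sets of exactly `k` elements
  obtain ⟨I, hI, hIk⟩ := Finset.exists_superset_card_eq (s := S.image Prod.fst) (n := k)
    (Finset.card_image_le.trans hSc) (by rw [Fintype.card_fin]; omega)
  obtain ⟨J, hJ, hJk⟩ := Finset.exists_superset_card_eq (s := S.image Prod.snd) (n := k)
    (Finset.card_image_le.trans hSc) (by rw [Fintype.card_fin]; omega)
  have hk' : (0 : ℝ) < k := by exact_mod_cast hk
  set t := √(3 / (5 * (k : ℝ))) with ht
  have htk : t ^ 2 * k ≤ 3 / 5 := by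
    rw [ht, Real.sq_sqrt (by positivity)]
    field_simp
    rfl
  have hPA := measure_not_nullSpaceProperty_le_of_isStrictlySubGaussian ha hA
    (hAB.precomp Sum.inl_injective) hk hk₁ hC hm₁ hIk
  have hPB := measure_not_nullSpaceProperty_le_of_isStrictlySubGaussian hb hB
    (hAB.precomp Sum.inr_injective) hk hk₂ hC hm₂ hJk
  have hcover : (Set.univ : Set Ω) ⊆ good ∪ ({ω | ¬ NullSpaceProperty (A ω) I t} ∪
      {ω | ¬ NullSpaceProperty (B ω) J t}) := by
    intro ω _
    by_cases h1 : NullSpaceProperty (A ω) I t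
    · by_cases h2 : NullSpaceProperty (B ω) J t
      · exact Or.inl (kroneckerL1Solutions_eq_singleton (Real.sqrt_nonneg _) htk h1 h2 hJk.le X₀
          (fun i j h => ⟨hI (Finset.mem_image_of_mem _ (hmem i j h)),
            hJ (Finset.mem_image_of_mem _ (hmem i j h))⟩) hX₀)
      · exact Or.inr (Or.inr h2)
    · exact Or.inr (Or.inl h1)
  have h1 : 1 ≤ P.real good + (P.real {ω | ¬ NullSpaceProperty (A ω) I t} +
      P.real {ω | ¬ NullSpaceProperty (B ω) J t}) := by
    rw [← probReal_univ (μ := P)]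
    exact (measureReal_mono hcover).trans ((measureReal_union_le _ _).trans
      (by gcongr; exact measureReal_union_le _ _))
  have hA' := ENNReal.toReal_le_of_le_ofReal (by positivity) hPA
  have hB' := ENNReal.toReal_le_of_le_ofReal (by positivity) hPB
  rw [← measureReal_def] at hA' hB'
  linarith
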